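/- A \emph{dagger category} is a category with a contravariant involution $\dagger$ that is the identity on objects; $f\colon A\to B$ is a \emph{dagger monomorphism} if $f^\dagger f=1_A$ and a \emph{dagger epimorphism} if $ff^\dagger=1_B$. A \emph{Hilbert category} is a dagger category $\mathbf C$ with a zero object and a chosen object $K$ such that: $K$ is a generator and is simple ($0$ and $K$ are its only subobjects, and $K\neq 0$); any two objects $A,B$ have a dagger biproduct (a product whose projections $p,q$ are dagger epimorphisms with $pq^\dagger=0$ and $qp^\dagger=0$); any two parallel morphisms have an equalizer that is a dagger monomorphism; every dagger monomorphism is a kernel; and the wide subcategory of dagger monomorphisms has (small) directed colimits. Parallel morphisms are added by $f+g=\nabla(f\oplus g)\Delta$, and $\mathbf C(K,K)$ carries this addition, composition as multiplication, and the involution $\dagger$. Let $\mathbf C$ be a Hilbert category. Then $\mathbf C(K,-)$ lifts to a full dagger functor $\mathbf C(K,-)\colon\mathbf C\to\mathbf{Hilb}_{\mathbf C(K,K)}$. In detail: (1) $\mathbf C(K,K)$ is isomorphic, as a ring with involution, to one of $\mathbb K=\mathbb R,\mathbb C,\mathbb H$ with its standard involution, in such a way that for every object $A$ the set $\mathbf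 C(K,A)$, with the above addition, the right scalar action $x\cdot\lambda=x\circ\lambda$ and the inner product $\langle x,y\rangle=y^\dagger x$, is a (complete) right Hilbert space over $\mathbf C(K,K)\cong\mathbb K$, and for every $f\colon A\to B$ the map $\mathbf C(K,f)=f\circ-$ is bounded. (2) For every identification of $\mathbf C(K,K)$ with $\mathbb R$, $\mathbb C$ or $\mathbb H$ as in (1), the resulting functor $\mathbf C(K,-)$ to the category of right Hilbert spaces and bounded right-linear maps satisfies $\mathbf C(K,f^\dagger)=\mathbf C(K,f)^\dagger$ (the adjoint) for all $f$, and it is full: for all objects $H_1,H_2$ and every bounded right-linear map $T\colon\mathbf C(K,H_1)\to\mathbf C(K,H_2)$ there is a morphism $t\colon H_1\to H_2$ in $\mathbf C$ with $T=\mathbf C(K,t)$. -/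

import Mathlib

open CategoryTheory CategoryTheory.Limits
open scoped Quaternion

universe v u

attribute [instance 10000] CategoryStruct.toQuiver

noncomputable section

/-! ## Dagger categories -/

/-- A dagger on a category: a contravariant involution which is the identity on objects. -/
class DaggerCategory (C : Type u) [Category.{v} C] where
  dag : ∀ {A B : C}, (A ⟶ B) → (B ⟶ A)
  dag_id : ∀ A : C, dag (𝟙 A) = 𝟙 A
  dag_comp : ∀ {A B D : C} (f : A ⟶ B) (g : B ⟶ D), dag (f ≫ g) = dag g ≫ dag f
  dag_dag : ∀ {A B : C} (f : A ⟶ B), dag (dag f) = f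

open DaggerCategory

/-- A dagger functor is a functor which preserves the daggers. -/
def IsDaggerFunctor {C : Type*} [Category* C] [DaggerCategory C] {D : Type*} [Category* D]
    [DaggerCategory D] (F : C ⥤ D) : Prop :=
  ∀ {A B : C} (f : A ⟶ B), F.map (dag f) = dag (F.map f)

section DaggerNotions

variable {C : Type u} [Category.{v} C] [DaggerCategory C]

/-- `f` is a dagger monomorphism: `f† ∘ f = 1`. -/
def IsDaggerMono {A B : C} (f : A ⟶ B) : Prop := f ≫ dag f = 𝟙 A

/-- `f` is a dagger epimorphism: `f ∘ f† = 1`. -/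
def IsDaggerEpi {A B : C} (f : A ⟶ B) : Prop := dag f ≫ f = 𝟙 B

variable (C) in
/-- The class of dagger monomorphisms. -/
def daggerMono : MorphismProperty C := fun _ _ f => IsDaggerMono f

instance : (daggerMono C).IsMultiplicative where
  id_mem A := by simp [daggerMono, IsDaggerMono, dag_id]
  comp_mem f g hf hg := by
    simp only [daggerMono, IsDaggerMono] at *
    rw [dag_comp, Category.assoc, ← Category.assoc g, hg, Category.id_comp, hf]

/-- A dagger biproduct of `A` and `B`: a product whose projections `p`, `q` are dagger
epimorphisms such that `p ∘ q†` and `q ∘ p†` are zero. -/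
structure IsDaggerBiproduct [HasZeroMorphisms C] {A B P : C} (p : P ⟶ A) (q : P ⟶ B) : Prop where
  epi_left : IsDaggerEpi p
  epi_right : IsDaggerEpi q
  zero_left : dag q ≫ p = 0
  zero_right : dag p ≫ q = 0
  isProduct : Nonempty (IsLimit (BinaryFan.mk p q))

variable (C) in
/-- Any two objects have a dagger biproduct. -/
class HasDaggerBiproducts [HasZeroMorphisms C] : Prop where
  exists_biproduct : ∀ A B : C, ∃ (P : C) (p : P ⟶ A) (q : P ⟶ B), IsDaggerBiproduct p q

theorem dag_zero [HasZeroMorphisms C] [HasZeroObject C] (A B : C) :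
    dag (0 : A ⟶ B) = (0 : B ⟶ A) := by
  have h : (0 : A ⟶ B) = (0 : A ⟶ (HasZeroObject.zero' C).zero) ≫ 0 := by simp
  rw [h, dag_comp]
  have h2 : dag (0 : (HasZeroObject.zero' C).zero ⟶ B) = 0 := (isZero_zero C).eq_of_tgt _ _
  rw [h2, zero_comp]

/-- A dagger biproduct is in particular a biproduct. -/
theorem hasBinaryBiproducts_of_dagger [HasZeroMorphisms C] [HasZeroObject C]
    [HasDaggerBiproducts C] : HasBinaryBiproducts C where
  has_binary_biproduct A B := by
    obtain ⟨P, p, q, h⟩ := HasDaggerBiproducts.exists_biproduct A B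
    obtain ⟨hl⟩ := h.isProduct
    have hp : dag p ≫ p = 𝟙 A := h.epi_left
    have hq : dag q ≫ q = 𝟙 B := h.epi_right
    have key : ∀ {X T : C} (r : P ⟶ X) (m : P ⟶ T), dag (dag r ≫ m) = dag m ≫ r := by
      intro X T r m
      rw [dag_comp, dag_dag]
    refine HasBinaryBiproduct.mk ⟨⟨P, p, q, dag p, dag q, hp, h.zero_right, h.zero_left, hq⟩,
      ⟨hl, ?_⟩⟩
    refine BinaryCofan.IsColimit.mk _
      (fun {T} f g => dag (BinaryFan.IsLimit.lift' hl (dag f) (dag g)).1) ?_ ?_ ?_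
    · intro T f g
      have := (BinaryFan.IsLimit.lift' hl (dag f) (dag g)).2.1
      replace this := congrArg dag this
      simpa [dag_comp, dag_dag] using this
    · intro T f g
      have := (BinaryFan.IsLimit.lift' hl (dag f) (dag g)).2.2
      replace this := congrArg dag this
      simpa [dag_comp, dag_dag] using this
    · intro T f g m h1 h2
      have : dag m = (BinaryFan.IsLimit.lift' hl (dag f) (dag g)).1 := by
        apply BinaryFan.IsLimit.hom_ext hl
        · rw [(BinaryFan.IsLimit.lift' hl (dag f) (dag g)).2.1, ← h1]
          exact (key p m).symm
        · rw [(BinaryFan.IsLimit.lift' hl (dag f) (dag g)).2.2, ← h2]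
          exact (key q m).symm
      rw [← this, dag_dag]

end DaggerNotions

/-! ## Hilbert categories -/

/-- A Hilbert category: a dagger category with a chosen simple generator `K`, a zero object and
dagger biproducts, dagger equalizers, in which every dagger monomorphism is a (dagger) kernel, and
whose wide subcategory of dagger monomorphisms has (small) directed colimits. -/
class HilbertCategory (C : Type u) [Category.{v} C] extends
    DaggerCategory C, HasZeroMorphisms C where
  K : C
  generator : IsSeparator K
  simple : Simple K
  hasZeroObject : HasZeroObject C
  hasDaggerBiproducts : HasDaggerBiproducts C
  exists_daggerEqualizer : ∀ {A B : C} (f g : A ⟶ B), ∃ (E : C) (m : E ⟶ A) (w : m ≫ f = m ≫ g),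
    IsDaggerMono m ∧ Nonempty (IsLimit (Fork.ofι m w))
  daggerMono_isKernel : ∀ {A B : C} (m : A ⟶ B), IsDaggerMono m → Nonempty (NormalMono m)
  hasDirectedColimits : ∀ (J : Type v) [PartialOrder J] [IsDirectedOrder J] [Nonempty J],
    HasColimitsOfShape J (WideSubcategory (daggerMono C))

attribute [instance] HilbertCategory.hasZeroObject HilbertCategory.hasDaggerBiproducts

instance {C : Type u} [Category.{v} C] [HilbertCategory C] : HasBinaryBiproducts C :=
  hasBinaryBiproducts_of_dagger

/-- The addition `f + g = ∇ ∘ (f ⊕ g) ∘ Δ` of parallel morphisms. -/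
def homAdd {C : Type u} [Category.{v} C] [HilbertCategory C] {A B : C} (f g : A ⟶ B) : A ⟶ B :=
  biprod.lift (𝟙 A) (𝟙 A) ≫ biprod.map f g ≫ biprod.desc (𝟙 B) (𝟙 B)

theorem homAdd_comp {C : Type u} [Category.{v} C] [HilbertCategory C] {A B D : C} (f g : A ⟶ B)
    (h : B ⟶ D) : homAdd f g ≫ h = homAdd (f ≫ h) (g ≫ h) := by
  simp only [homAdd, Category.assoc]
  congr 1
  ext <;> simp

/-! ## Real, complex and quaternionic Hilbert spaces -/

/-- The scalars of Hilbert spaces: `ℝ`, `ℂ` and `ℍ` with their usual involution and norm satisfy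
`k* k = |k|²`. -/
class HilbertScalars (𝕂 : Type*) [NormedDivisionRing 𝕂] [StarRing 𝕂] [NormedAlgebra ℝ 𝕂] :
    Prop where
  star_mul_self : ∀ k : 𝕂, star k * k = algebraMap ℝ 𝕂 (‖k‖ ^ 2)

instance : HilbertScalars ℝ where
  star_mul_self k := by simp [sq]

instance : HilbertScalars ℂ where
  star_mul_self k := by
    simpa [Complex.normSq_eq_norm_sq] using (Complex.normSq_eq_conj_mul_self (z := k)).symm

instance : HilbertScalars ℍ[ℝ] where
  star_mul_self k := by
    rw [Quaternion.star_mul_self, Quaternion.normSq_eq_norm_mul_self, sq]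
    rfl

/-- A right Hilbert space over `𝕂`: the form `⟪x, y⟫` is linear in `x` and conjugate linear in `y`
for the right action of `𝕂` (that is, the left action of `𝕂ᵐᵒᵖ`), `‖x‖² = ⟪x, x⟫`, and the
norm is complete. -/
class RightHilbertSpace (𝕂 : Type*) [NormedDivisionRing 𝕂] [StarRing 𝕂] [NormedAlgebra ℝ 𝕂]
    (V : Type*) [NormedAddCommGroup V] [Module 𝕂ᵐᵒᵖ V] where
  form : V → V → 𝕂
  form_add_left : ∀ x y z : V, form (x + y) z = form x z + form y z
  form_smul_left : ∀ (x y : V) (k : 𝕂), form (MulOpposite.op k • x) y = form x y * k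
  star_form : ∀ x y : V, star (form x y) = form y x
  form_self : ∀ x : V, form x x = algebraMap ℝ 𝕂 (‖x‖ ^ 2)
  complete : CompleteSpace V

section Adjoint

variable {𝕂 : Type*} [NormedDivisionRing 𝕂] [StarRing 𝕂] [NormedAlgebra ℝ 𝕂] [HilbertScalars 𝕂]

/-- The real part. -/
def scalarRe (k : 𝕂) : ℝ := (‖1 + k‖ ^ 2 - 1 - ‖k‖ ^ 2) / 2

theorem algebraMap_scalarRe (k : 𝕂) : algebraMap ℝ 𝕂 (2 * scalarRe k) = k + star k := by
  have h1 := HilbertScalars.star_mul_self (1 + k)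
  have h2 := HilbertScalars.star_mul_self k
  have : 2 * scalarRe k = ‖1 + k‖ ^ 2 - 1 - ‖k‖ ^ 2 := by unfold scalarRe; ring
  rw [this, map_sub, map_sub, ← h1, ← h2, map_one, star_add, star_one]
  noncomm_ring

theorem star_algebraMap_real (r : ℝ) : star (algebraMap ℝ 𝕂 r) = algebraMap ℝ 𝕂 r := by
  by_cases hr : r = 0
  · simp [hr]
  · have h := HilbertScalars.star_mul_self (algebraMap ℝ 𝕂 r)
    rw [norm_algebraMap', Real.norm_eq_abs, sq_abs, sq, map_mul] at h
    exact mul_right_cancel₀ (by simpa using hr) h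

theorem scalarRe_eq_iff {a : 𝕂} {r : ℝ} : scalarRe a = r ↔ a + star a = algebraMap ℝ 𝕂 (2 * r) := by
  rw [← algebraMap_scalarRe, (algebraMap ℝ 𝕂).injective.eq_iff]
  constructor <;> intro h <;> linarith

theorem scalarRe_algebraMap (r : ℝ) : scalarRe (algebraMap ℝ 𝕂 r) = r := by
  rw [scalarRe_eq_iff, star_algebraMap_real, two_mul, map_add]

theorem scalarRe_add (a b : 𝕂) : scalarRe (a + b) = scalarRe a + scalarRe b := by
  rw [scalarRe_eq_iff, mul_add, map_add, algebraMap_scalarRe, algebraMap_scalarRe, star_add]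
  abel

theorem scalarRe_mul_real (a : 𝕂) (r : ℝ) : scalarRe (a * algebraMap ℝ 𝕂 r) = r * scalarRe a := by
  rw [scalarRe_eq_iff, mul_left_comm, map_mul, algebraMap_scalarRe, star_mul, star_algebraMap_real,
    mul_add, (Algebra.commutes r a)]

theorem scalarRe_star (a : 𝕂) : scalarRe (star a) = scalarRe a := by
  rw [scalarRe_eq_iff, algebraMap_scalarRe, star_star, add_comm]

theorem eq_of_scalarRe_mul {a b : 𝕂} (h : ∀ k, scalarRe (a * k) = scalarRe (b * k)) : a = b := by
  have h1 : ∀ k, scalarRe ((a - b) * k) = 0 := by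
    intro k
    have := scalarRe_add ((a - b) * k) (b * k)
    rw [sub_mul, sub_add_cancel, h k] at this
    rw [sub_mul]
    linarith
  have h2 := HilbertScalars.star_mul_self (star (a - b))
  rw [star_star] at h2
  have h3 := h1 (star (a - b))
  rw [h2, scalarRe_algebraMap] at h3
  simpa [sub_eq_zero] using h3

namespace RightHilbertSpace

variable {V : Type*} [NormedAddCommGroup V] [Module 𝕂ᵐᵒᵖ V] [RightHilbertSpace 𝕂 V]
  {W : Type*} [NormedAddCommGroup W] [Module 𝕂ᵐᵒᵖ W] [RightHilbertSpace 𝕂 W]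

set_option linter.unusedSectionVars false in
variable (𝕂) in
theorem ext_form {y z : V} (h : ∀ x : V, form (𝕂 := 𝕂) x y = form x z) : y = z := by
  have key : ∀ x : V, form (𝕂 := 𝕂) (y - z) x = 0 := by
    intro x
    have h1 := form_add_left (𝕂 := 𝕂) (y - z) z x
    rw [sub_add_cancel, ← star_form x y, h x, star_form] at h1
    exact right_eq_add.mp h1
  have := form_self (𝕂 := 𝕂) (y - z)
  rw [key] at this
  have h2 := (map_eq_zero (algebraMap ℝ 𝕂)).mp this.symm
  simpa [sub_eq_zero] using h2

variable (𝕂) (V) in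
/-- The underlying real vector space. -/
abbrev realModule : Module ℝ V := Module.compHom V (algebraMap ℝ 𝕂ᵐᵒᵖ)

variable (𝕂) (V) in
/-- The underlying real inner product space. -/
abbrev realCore : letI := realModule 𝕂 V; InnerProductSpace.Core ℝ V :=
  letI := realModule 𝕂 V
  { inner := fun x y => scalarRe (form (𝕂 := 𝕂) x y)
    conj_inner_symm := fun x y => by
      simp only [conj_trivial]
      rw [← star_form x y, scalarRe_star]
    re_inner_nonneg := fun x => by
      simp only [form_self, scalarRe_algebraMap, RCLike.re_to_real]
      positivity
    add_left := fun x y z => by simp only [form_add_left, scalarRe_add]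
    smul_left := fun x y r => by
      change scalarRe (form (MulOpposite.op (algebraMap ℝ 𝕂 r) • x) y) = _
      rw [form_smul_left, scalarRe_mul_real]; rfl
    definite := fun x hx => by
      simpa only [form_self, scalarRe_algebraMap, sq_eq_zero_iff, norm_eq_zero] using hx }

variable (𝕂) in
theorem norm_smul_real (r : ℝ) (x : V) : letI := realModule 𝕂 V; ‖r • x‖ = ‖r‖ * ‖x‖ := by
  let := realModule 𝕂 V
  have h := form_self (𝕂 := 𝕂) (r • x)
  have h1 : r • x = MulOpposite.op (algebraMap ℝ 𝕂 r) • x := rfl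
  rw [h1, form_smul_left, ← star_form, form_smul_left, star_mul, form_self, star_algebraMap_real,
    star_algebraMap_real, ← map_mul, ← map_mul, (algebraMap ℝ 𝕂).injective.eq_iff] at h
  rw [h1, ← sq_eq_sq₀ (by positivity) (by positivity), ← h, mul_pow, Real.norm_eq_abs, sq_abs]
  ring

variable (𝕂) (V) in
abbrev realInner : InnerProductSpace ℝ V :=
  letI := realModule 𝕂 V
  { realModule 𝕂 V, realCore 𝕂 V with
    norm_smul_le := fun r x => (norm_smul_real 𝕂 r x).le
    norm_sq_eq_re_inner := fun x => by
      change _ = scalarRe (form (𝕂 := 𝕂) x x)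
      rw [form_self, scalarRe_algebraMap] }

/-- Every bounded right linear map between right Hilbert spaces has an adjoint. -/
theorem exists_adjoint (T : V →L[𝕂ᵐᵒᵖ] W) :
    ∃ S : W →L[𝕂ᵐᵒᵖ] V, ∀ x y, form (𝕂 := 𝕂) (T x) y = form x (S y) := by
  let := realInner 𝕂 V
  let := realInner 𝕂 W
  have : CompleteSpace V := complete 𝕂
  have : CompleteSpace W := complete 𝕂
  let T' : V →L[ℝ] W :=
    { toFun := T, map_add' := map_add T, map_smul' := fun r x => T.map_smul _ x, cont := T.cont }
  let S' : W →L[ℝ] V := ContinuousLinearMap.adjoint T'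
  have h0 : ∀ x y, scalarRe (form (𝕂 := 𝕂) (T x) y) = scalarRe (form (𝕂 := 𝕂) x (S' y)) :=
    fun x y => (ContinuousLinearMap.adjoint_inner_right T' x y).symm
  have h1 : ∀ x y, form (𝕂 := 𝕂) (T x) y = form x (S' y) := by
    intro x y
    apply eq_of_scalarRe_mul
    intro k
    rw [← form_smul_left, ← form_smul_left, ← h0, map_smul]
  refine ⟨⟨⟨⟨S', map_add S'⟩, ?_⟩, S'.cont⟩, h1⟩
  intro k y
  apply ext_form 𝕂
  intro x
  change form x (S' (k • y)) = form x (k • S' y)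
  obtain ⟨k, rfl⟩ := MulOpposite.op_surjective k
  rw [← h1, ← star_form (MulOpposite.op k • y), form_smul_left,
    ← star_form (MulOpposite.op k • S' y), form_smul_left, star_mul, star_mul,
    star_form, star_form, h1]

/-- The adjoint of a bounded right linear map. -/
def adjoint (T : V →L[𝕂ᵐᵒᵖ] W) : W →L[𝕂ᵐᵒᵖ] V := (exists_adjoint T).choose

theorem form_adjoint (T : V →L[𝕂ᵐᵒᵖ] W) (x : V) (y : W) :
    form (𝕂 := 𝕂) (T x) y = form x (adjoint T y) := (exists_adjoint T).choose_spec x y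

theorem eq_adjoint (T : V →L[𝕂ᵐᵒᵖ] W) (S : W →L[𝕂ᵐᵒᵖ] V)
    (h : ∀ x y, form (𝕂 := 𝕂) (T x) y = form x (S y)) : S = adjoint T := by
  ext y
  apply ext_form 𝕂
  intro x
  rw [← h, form_adjoint]

end RightHilbertSpace

end Adjoint

/-- An object of the category of right Hilbert spaces over `𝕂`. -/
structure HilbCat (𝕂 : Type*) [NormedDivisionRing 𝕂] [StarRing 𝕂] [NormedAlgebra ℝ 𝕂] where
  carrier : Type v
  [group : NormedAddCommGroup carrier]
  [module : Module 𝕂ᵐᵒᵖ carrier]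
  [hilbert : RightHilbertSpace 𝕂 carrier]

namespace HilbCat

attribute [instance] HilbCat.group HilbCat.module HilbCat.hilbert

variable {𝕂 : Type*} [NormedDivisionRing 𝕂] [StarRing 𝕂] [NormedAlgebra ℝ 𝕂]

/-- Morphisms are the bounded (continuous) right linear maps. -/
instance : Category.{v} (HilbCat.{v} 𝕂) where
  Hom V W := V.carrier →L[𝕂ᵐᵒᵖ] W.carrier
  id V := ContinuousLinearMap.id 𝕂ᵐᵒᵖ V.carrier
  comp f g := g.comp f

variable [HilbertScalars 𝕂]

/-- The dagger of a bounded right linear map is its adjoint. -/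
instance : DaggerCategory (HilbCat.{v} 𝕂) where
  dag {V W} T := RightHilbertSpace.adjoint (V := V.carrier) (W := W.carrier) T
  dag_id V := (RightHilbertSpace.eq_adjoint (ContinuousLinearMap.id 𝕂ᵐᵒᵖ V.carrier)
    (ContinuousLinearMap.id 𝕂ᵐᵒᵖ V.carrier) fun _ _ => rfl).symm
  dag_comp {U V W} := fun (f : U.carrier →L[𝕂ᵐᵒᵖ] V.carrier) (g : V.carrier →L[𝕂ᵐᵒᵖ] W.carrier) =>
    (RightHilbertSpace.eq_adjoint (g.comp f)
      ((RightHilbertSpace.adjoint f).comp (RightHilbertSpace.adjoint g)) fun x y => by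
        rw [ContinuousLinearMap.comp_apply, ContinuousLinearMap.comp_apply,
          RightHilbertSpace.form_adjoint, RightHilbertSpace.form_adjoint]).symm
  dag_dag {V W} := fun (f : V.carrier →L[𝕂ᵐᵒᵖ] W.carrier) =>
    (RightHilbertSpace.eq_adjoint (RightHilbertSpace.adjoint f) f fun x y => by
      rw [← RightHilbertSpace.star_form, ← RightHilbertSpace.form_adjoint,
        RightHilbertSpace.star_form]).symm

end HilbCat

/-! ## The functor `C(K, -)` -/

/-- A lifting of the functor `C(K, -)` to right Hilbert spaces over `𝕂`: an isomorphism of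
involutive rings between `C(K, K)` (with the biproduct addition, composition, and the dagger) and
`𝕂`, and on each `C(K, A)` the structure of a right Hilbert space whose addition is the biproduct
addition, whose scalar multiplication is composition with scalars `K ⟶ K`, and whose inner product
is `⟪x, y⟫ = y† ∘ x`; the maps `C(K, f)` are required to be bounded. -/
structure HomLift (C : Type u) [Category.{v} C] [HilbertCategory C] (𝕂 : Type*)
    [NormedDivisionRing 𝕂] [StarRing 𝕂] [NormedAlgebra ℝ 𝕂] where
  scalar : ((HilbertCategory.K : C) ⟶ HilbertCategory.K) ≃ 𝕂
  scalar_add : ∀ a b, scalar (homAdd a b) = scalar a + scalar b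
  scalar_comp : ∀ a b, scalar (b ≫ a) = scalar a * scalar b
  scalar_dag : ∀ a, scalar (dag a) = star (scalar a)
  group : ∀ A : C, NormedAddCommGroup (HilbertCategory.K ⟶ A)
  module : ∀ A : C, Module 𝕂ᵐᵒᵖ (HilbertCategory.K ⟶ A)
  hilbert : ∀ A : C, RightHilbertSpace 𝕂 (HilbertCategory.K ⟶ A)
  add_eq : ∀ {A : C} (x y : HilbertCategory.K ⟶ A), x + y = homAdd x y
  smul_eq : ∀ {A : C} (x : HilbertCategory.K ⟶ A) (a : (HilbertCategory.K : C) ⟶ HilbertCategory.K),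
    MulOpposite.op (scalar a) • x = a ≫ x
  form_eq : ∀ {A : C} (x y : HilbertCategory.K ⟶ A),
    (hilbert A).form x y = scalar (x ≫ dag y)
  continuous_comp : ∀ {A B : C} (f : A ⟶ B),
    Continuous fun x : HilbertCategory.K ⟶ A => x ≫ f

namespace HomLift

variable {C : Type u} [Category.{v} C] [HilbertCategory C] {𝕂 : Type*}
    [NormedDivisionRing 𝕂] [StarRing 𝕂] [NormedAlgebra ℝ 𝕂]

/-- The functor `C(K, -)` into right Hilbert spaces over `C(K, K) ≅ 𝕂`: it sends `A` to `C(K, A)`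
and `f` to composition with `f`. -/
def functor (L : HomLift C 𝕂) : C ⥤ HilbCat.{v} 𝕂 where
  obj A := @HilbCat.mk 𝕂 _ _ _ (HilbertCategory.K ⟶ A) (L.group A) (L.module A) (L.hilbert A)
  map {A B} f :=
    letI := L.group A
    letI := L.module A
    letI := L.group B
    letI := L.module B
    ({ toFun := fun x => x ≫ f
       map_add' := fun x y => by rw [L.add_eq, L.add_eq, homAdd_comp]
       map_smul' := fun k x => by
        obtain ⟨k, rfl⟩ := MulOpposite.op_surjective k
        obtain ⟨a, rfl⟩ := L.scalar.surjective k
        rw [RingHom.id_apply, L.smul_eq, L.smul_eq, Category.assoc]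
       cont := L.continuous_comp f } :
      (HilbertCategory.K ⟶ A) →L[𝕂ᵐᵒᵖ] (HilbertCategory.K ⟶ B))
  map_id A := by
    let := L.group A
    let := L.module A
    exact ContinuousLinearMap.ext fun x => Category.comp_id x
  map_comp {A B D} f g := by
    let := L.group A
    let := L.module A
    let := L.group D
    let := L.module D
    exact ContinuousLinearMap.ext fun x => (Category.assoc x f g).symm

end HomLift

end

/-!
The heart of the matter is a statement about suprema: for a directed system of dagger monomorphisms
with colimit `Z`, a compatible family of vectors `p i` whose norms `p i† p i` are bounded by `b`
comes from a vector of `Z` whose norm is bounded by `b` too (`IsDaggerColimit.exists_vector`). It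
follows from the existence of a second colimit: add to each `F i` a summand spanned by a vector
`y i` with `y i† y i = b - p i† p i`; then the vectors `(p i, y i)` are carried to each other by the
transition morphisms, so they define one vector of the colimit, which is projected to `Z`.

For increasing sequences this makes the division ring `C(K, K)`, ordered by the cone of all `x† x`,
monotone complete (`exists_isLUB_of_isPos`). In a monotone complete division ring with involution,
positive elements below `1` have square roots (`exists_sqrt`), so symmetric elements are comparable
with zero (`nonneg_or_nonpos`); then they have integer parts, and are central because the commutator
of `n a` and `d` is bounded independently of `n` (`commute_of_star_eq`). Hence the symmetric
elements form a complete Archimedean ordered field, which is `ℝ`, and a Frobenius argument shows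
that the ring is `ℝ`, `ℂ` or `ℍ` (`MonotoneCompleteDivisionRing.nonempty_starRingEquiv`).

Now nonzero vectors can be normalized, so every object has an orthonormal basis, and it is the
directed colimit of the spans of the finite subsets of that basis. The statement about suprema
becomes the Riesz–Fischer theorem (`IsOrthonormalBasis.exists_vector`), so `C(K, A)` is an `ℓ²`
space and is complete (`completeSpace_hom`). The maps `C(K, f)` have formal adjoints `C(K, f†)`, so
they are bounded by the closed graph theorem.

For fullness, the universal property of the colimit gives a morphism with any prescribed orthonormal
values on an orthonormal basis (`IsOrthonormalBasis.exists_hom`). A bounded operator is a multiple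
of a strict contraction `T'`, and `x ↦ (T' x, (1 - T'* T')^(1/2) x)` is an isometry
(`RightHilbertSpace.exists_dilation`), so this isometry comes from a morphism, and `T'` is its first
component.
-/

open DaggerCategory

namespace HilbertCategory

/-! ### Addition of morphisms -/

section Semiadditive

variable {C : Type u} [Category.{v} C] [HilbertCategory C]

/-- `homAdd` is one of Mathlib's additions in a category with biproducts, with known laws. -/
theorem homAdd_eq_rightAdd {A B : C} (f g : A ⟶ B) :
    homAdd f g = SemiadditiveOfBinaryBiproducts.rightAdd A B f g := by
  simp only [homAdd, SemiadditiveOfBinaryBiproducts.rightAdd]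
  congr 1
  ext <;> simp

/-- The commutative monoid structure on morphisms given by `homAdd`. -/
noncomputable abbrev homAddCommMonoid (A B : C) : AddCommMonoid (A ⟶ B) where
  add := homAdd
  zero := 0
  add_assoc f g h := by
    change homAdd (homAdd f g) h = homAdd f (homAdd g h)
    simp only [homAdd_eq_rightAdd]
    exact (SemiadditiveOfBinaryBiproducts.addCommMonoidHomOfHasBinaryBiproducts A B).add_assoc f g h
  zero_add f := (homAdd_eq_rightAdd 0 f).trans
    ((SemiadditiveOfBinaryBiproducts.addCommMonoidHomOfHasBinaryBiproducts A B).zero_add f)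
  add_zero f := (homAdd_eq_rightAdd f 0).trans
    ((SemiadditiveOfBinaryBiproducts.addCommMonoidHomOfHasBinaryBiproducts A B).add_zero f)
  add_comm f g := by
    change homAdd f g = homAdd g f
    simp only [homAdd_eq_rightAdd]
    exact (SemiadditiveOfBinaryBiproducts.addCommMonoidHomOfHasBinaryBiproducts A B).add_comm f g
  nsmul := letI : Add (A ⟶ B) := ⟨homAdd⟩; letI : Zero (A ⟶ B) := ⟨0⟩; nsmulRec

attribute [local instance] homAddCommMonoid

theorem hom_add_comp {A B D : C} (f g : A ⟶ B) (h : B ⟶ D) :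
    (f + g) ≫ h = f ≫ h + g ≫ h :=
  homAdd_comp f g h

theorem hom_comp_add {A B D : C} (f : A ⟶ B) (g h : B ⟶ D) :
    f ≫ (g + h) = f ≫ g + f ≫ h := by
  change f ≫ homAdd g h = homAdd (f ≫ g) (f ≫ h)
  simp only [homAdd_eq_rightAdd]
  exact SemiadditiveOfBinaryBiproducts.comp_add f g h

/-- Orthogonal direct sums, described by the two inclusions. The last clause says that the
inclusions are jointly a dagger isomorphism. -/
theorem exists_orthogonal_sum (A B : C) : ∃ (P : C) (i : A ⟶ P) (j : B ⟶ P),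
    i ≫ dag i = 𝟙 A ∧ j ≫ dag j = 𝟙 B ∧ i ≫ dag j = 0 ∧ j ≫ dag i = 0 ∧
      dag i ≫ i + dag j ≫ j = 𝟙 P := by
  obtain ⟨P, p, q, h⟩ := HasDaggerBiproducts.exists_biproduct A B
  have hp : dag p ≫ p = 𝟙 A := h.epi_left
  have hq : dag q ≫ q = 𝟙 B := h.epi_right
  refine ⟨P, dag p, dag q, by rwa [dag_dag], by rwa [dag_dag], by rw [dag_dag, h.zero_right],
    by rw [dag_dag, h.zero_left], ?_⟩
  obtain ⟨hl⟩ := h.isProduct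
  rw [dag_dag, dag_dag]
  have e1 : (p ≫ dag p + q ≫ dag q) ≫ p = 𝟙 P ≫ p := by
    rw [hom_add_comp, Category.assoc, Category.assoc, hp, h.zero_left]
    simp
  have e2 : (p ≫ dag p + q ≫ dag q) ≫ q = 𝟙 P ≫ q := by
    rw [hom_add_comp, Category.assoc, Category.assoc, hq, h.zero_right]
    simp
  exact BinaryFan.IsLimit.hom_ext hl e1 e2

theorem dag_add {A B : C} (f g : A ⟶ B) : dag (f + g) = dag f + dag g := by
  -- `f + g` is the pairing of `f` and `g` followed by the codiagonal `dag i + dag j`, so it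
  -- suffices to know the dagger of the codiagonal.
  obtain ⟨P, i, j, hi, hj, hij, hji, hs⟩ := exists_orthogonal_sum B B
  have h1 : dag (dag i + dag j) = i + j := by
    have e : dag (dag i + dag j) = dag (dag i + dag j) ≫ (dag i ≫ i + dag j ≫ j) := by
      rw [hs, Category.comp_id]
    have e1 : dag (dag i + dag j) ≫ dag i = 𝟙 B := by
      rw [← dag_comp, hom_comp_add, hi, hij, add_zero, dag_id]
    have e2 : dag (dag i + dag j) ≫ dag j = 𝟙 B := by
      rw [← dag_comp, hom_comp_add, hj, hji, zero_add, dag_id]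
    rw [e, hom_comp_add, ← Category.assoc, ← Category.assoc, e1, e2, Category.id_comp,
      Category.id_comp]
  have h2 : f + g = (f ≫ i + g ≫ j) ≫ (dag i + dag j) := by
    simp only [hom_add_comp, hom_comp_add, Category.assoc, hi, hj, hij, hji]
    simp
  have h3 : (i + j) ≫ dag (f ≫ i + g ≫ j) = dag f + dag g := by
    rw [hom_add_comp, ← dag_dag i, ← dag_comp, ← dag_dag j, ← dag_comp, dag_dag, dag_dag]
    simp only [hom_add_comp, Category.assoc, hi, hj, hij, hji]
    simp
  rw [h2, dag_comp, h1, h3]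

/-! ### Dagger kernels and the scalars -/

theorem hom_ext_generator {A B : C} {f g : A ⟶ B} (h : ∀ x : (K : C) ⟶ A, x ≫ f = x ≫ g) :
    f = g :=
  IsSeparator.def generator f g h

theorem id_K_ne_zero : 𝟙 (K : C) ≠ 0 := by
  have : Simple (K : C) := simple
  exact id_nonzero K

/-- Every morphism has a kernel which is a dagger monomorphism. -/
theorem exists_daggerKernel {A B : C} (f : A ⟶ B) : ∃ (N : C) (n : N ⟶ A),
    n ≫ dag n = 𝟙 N ∧ n ≫ f = 0 ∧ ∀ {T : C} (g : T ⟶ A), g ≫ f = 0 → g = (g ≫ dag n) ≫ n := by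
  obtain ⟨N, n, w, hn, ⟨hl⟩⟩ := exists_daggerEqualizer f (0 : A ⟶ B)
  refine ⟨N, n, hn, by simpa using w, fun {T} g hg => ?_⟩
  obtain ⟨(l : T ⟶ N), (hl' : l ≫ n = g)⟩ := Fork.IsLimit.lift' hl g (by simpa using hg)
  have hn' : n ≫ dag n = 𝟙 N := hn
  rw [← hl', Category.assoc l, hn', Category.comp_id]

/-- The orthogonal complement of a dagger subobject `m`; the last clause is the decomposition of
the ambient object as an orthogonal sum. -/
theorem exists_complement {M A : C} (m : M ⟶ A) (hm : m ≫ dag m = 𝟙 M) :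
    ∃ (N : C) (n : N ⟶ A), n ≫ dag n = 𝟙 N ∧ n ≫ dag m = 0 ∧ m ≫ dag n = 0 ∧
      dag m ≫ m + dag n ≫ n = 𝟙 A := by
  obtain ⟨N, n, hn, hnm, hu⟩ := exists_daggerKernel (dag m)
  have hmn : m ≫ dag n = 0 := by
    have := congrArg dag hnm
    rwa [dag_comp, dag_dag, dag_zero] at this
  refine ⟨N, n, hn, hnm, hmn, ?_⟩
  obtain ⟨P, i, j, hi, hj, hij, hji, hs⟩ := exists_orthogonal_sum M N
  -- The copairing `c` of `m` and `n` is a dagger monomorphism, hence a kernel. A morphism which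
  -- vanishes on `m` and on `n` is zero, so `c` is the kernel of a zero morphism.
  let c : P ⟶ A := dag i ≫ m + dag j ≫ n
  have hic : i ≫ c = m := by
    simp only [c, hom_comp_add, ← Category.assoc, hi, hij, zero_comp, add_zero, Category.id_comp]
  have hjc : j ≫ c = n := by
    simp only [c, hom_comp_add, ← Category.assoc, hj, hji, zero_comp, zero_add, Category.id_comp]
  have hdc : dag c = dag m ≫ i + dag n ≫ j := by
    simp only [c, dag_add, dag_comp, dag_dag]
  have hc : IsDaggerMono c := by
    rw [IsDaggerMono, hdc, hom_comp_add]
    simp only [c, hom_add_comp, ← Category.assoc]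
    simp only [Category.assoc _ m, Category.assoc _ n, hm, hn, hmn, hnm]
    simpa using hs
  obtain ⟨k⟩ := daggerMono_isKernel c hc
  have hz : k.g = 0 := by
    have h1 : m ≫ k.g = 0 := by rw [← hic, Category.assoc, k.w, comp_zero]
    have h2 : n ≫ k.g = 0 := by rw [← hjc, Category.assoc, k.w, comp_zero]
    have h3 : dag k.g ≫ dag m = 0 := by rw [← dag_comp, h1, dag_zero]
    have h4 := hu _ h3
    rw [← dag_comp n, h2, dag_zero, zero_comp] at h4
    rw [← dag_dag k.g, h4, dag_zero]
  obtain ⟨(l : A ⟶ P), (hl' : l ≫ c = 𝟙 A)⟩ :=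
    Fork.IsLimit.lift' k.isLimit (𝟙 A) (by simp [hz])
  have : dag c = l := by
    have hc' : c ≫ dag c = 𝟙 P := hc
    rw [← Category.id_comp (dag c), ← hl', Category.assoc, hc', Category.comp_id]
  rw [← this, hdc, hom_add_comp, Category.assoc, Category.assoc, hic, hjc] at hl'
  exact hl'

/-- The inner product is anisotropic. -/
theorem eq_zero_of_comp_dag_eq_zero {A B : C} {f : A ⟶ B} (h : f ≫ dag f = 0) : f = 0 := by
  obtain ⟨N, n, hn, hnf, hu⟩ := exists_daggerKernel (dag f)
  have h1 := hu f h
  have h2 : f ≫ dag n = 0 := by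
    have := congrArg dag hnf
    rwa [dag_comp, dag_dag, dag_zero] at this
  rw [h1, h2, zero_comp]

/-- A morphism with zero kernel is a monomorphism: it is tested against the dagger equalizer of two
morphisms, which is a kernel. -/
theorem mono_of_kernel_eq_zero {A B : C} (f : A ⟶ B)
    (hf : ∀ {T : C} (g : T ⟶ A), g ≫ f = 0 → g = 0) : Mono f := by
  constructor
  intro T g h hgh
  obtain ⟨E, m, w, hm, ⟨hl⟩⟩ := exists_daggerEqualizer (dag g) (dag h)
  have hm' : m ≫ dag m = 𝟙 E := hm
  obtain ⟨(l : B ⟶ E), (hl' : l ≫ m = dag f)⟩ :=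
    Fork.IsLimit.lift' hl (dag f) (by rw [← dag_comp, hgh, dag_comp])
  obtain ⟨N, n, hn, hnm, hmn, hs⟩ := exists_complement m hm'
  have h1 : n ≫ f = 0 := by
    rw [← dag_dag f, ← hl', dag_comp, ← Category.assoc, hnm, zero_comp]
  have h2 := hf n h1
  rw [h2, comp_zero, add_zero] at hs
  have h3 : dag g = dag h := by
    rw [← Category.id_comp (dag g), ← hs, Category.assoc, w, ← Category.assoc, hs, Category.id_comp]
  rw [← dag_dag g, h3, dag_dag]

theorem mono_of_ne_zero {A : C} {x : (K : C) ⟶ A} (hx : x ≠ 0) : Mono x := by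
  have : Simple (K : C) := simple
  obtain ⟨N, n, hn, hnx, hu⟩ := exists_daggerKernel x
  have hmono : Mono n := by
    constructor
    intro T g h hgh
    rw [← Category.comp_id g, ← hn, ← Category.assoc, hgh, Category.assoc, hn, Category.comp_id]
  have hn0 : n = 0 := by
    by_contra h0
    have := isIso_of_mono_of_nonzero h0
    exact hx (by rw [← cancel_epi n, hnx, comp_zero])
  apply mono_of_kernel_eq_zero
  intro T g hg
  rw [hu g hg, hn0, comp_zero]

theorem isIso_scalar {a : (K : C) ⟶ K} (ha : a ≠ 0) : IsIso a := by
  have : Simple (K : C) := simple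
  have := mono_of_ne_zero ha
  exact isIso_of_mono_of_nonzero ha

/-! ### Negatives -/

/-- The scalar `-1` exists: otherwise the codiagonal of `K` would be a monomorphism. -/
theorem exists_neg_one_scalar : ∃ a : (K : C) ⟶ K, a + 𝟙 K = 0 := by
  obtain ⟨P, i, j, hi, hj, hij, hji, hs⟩ := exists_orthogonal_sum (K : C) K
  have h1 : ∃ x : (K : C) ⟶ P, x ≫ (dag i + dag j) = 0 ∧ x ≠ 0 := by
    by_contra! hcon
    have : Mono (dag i + dag j) := by
      apply mono_of_kernel_eq_zero
      intro T g hg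
      apply hom_ext_generator
      intro x
      rw [comp_zero]
      exact hcon _ (by rw [Category.assoc, hg, comp_zero])
    have h2 : i = j := by
      rw [← cancel_mono (dag i + dag j), hom_comp_add, hom_comp_add, hi, hj, hij, hji, add_zero,
        zero_add]
    rw [← h2, hi] at hij
    exact id_K_ne_zero hij
  obtain ⟨x, hx, hx0⟩ := h1
  rw [hom_comp_add] at hx
  have hb : x ≫ dag j ≠ 0 := by
    intro hb
    rw [hb, add_zero] at hx
    apply hx0
    rw [← Category.comp_id x, ← hs, hom_comp_add, ← Category.assoc, ← Category.assoc, hx, hb]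
    simp
  have := isIso_scalar hb
  refine ⟨inv (x ≫ dag j) ≫ x ≫ dag i, ?_⟩
  rw [← IsIso.inv_hom_id (x ≫ dag j), ← hom_comp_add, hx, comp_zero]

/-- Every object has an endomorphism `-1`. It is read off from the kernel `(n₁, n₂)` of the
codiagonal `A ⊕ A ⟶ A`: the component `n₁` is invertible with inverse `2 n₁†`. -/
theorem exists_neg_one (A : C) : ∃ a : A ⟶ A, a + 𝟙 A = 0 := by
  obtain ⟨ε, hε⟩ := exists_neg_one_scalar (C := C)
  obtain ⟨P, i, j, hi, hj, hij, hji, hs⟩ := exists_orthogonal_sum A A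
  obtain ⟨N, n, hn, hnd, hu⟩ := exists_daggerKernel (dag i + dag j)
  have hsum : n ≫ dag i + n ≫ dag j = 0 := by rw [← hom_comp_add, hnd]
  generalize hn1 : n ≫ dag i = n1 at hsum
  generalize hn2 : n ≫ dag j = n2 at hsum
  have hdsum : dag n1 + dag n2 = 0 := by rw [← dag_add, hsum, dag_zero]
  have hone : n1 ≫ dag n1 + n2 ≫ dag n2 = 𝟙 N := by
    rw [← hn, ← hn1, ← hn2]
    simp only [dag_comp, dag_dag, Category.assoc]
    rw [← hom_comp_add]
    simp only [← Category.assoc]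
    rw [← hom_add_comp, hs, Category.id_comp]
  have e1 : n1 ≫ dag n1 + n1 ≫ dag n2 = 0 := by rw [← hom_comp_add, hdsum, comp_zero]
  have e2 : n2 ≫ dag n2 + n1 ≫ dag n2 = 0 := by
    rw [← hom_add_comp, add_comm, hsum, zero_comp]
  have e3 : n2 ≫ dag n2 = n1 ≫ dag n1 := by
    calc n2 ≫ dag n2 = n2 ≫ dag n2 + (n1 ≫ dag n1 + n1 ≫ dag n2) := by rw [e1, add_zero]
      _ = n1 ≫ dag n1 + (n2 ≫ dag n2 + n1 ≫ dag n2) := by abel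
      _ = _ := by rw [e2, add_zero]
  have hg1 : n1 ≫ (dag n1 + dag n1) = 𝟙 N := by rw [hom_comp_add, ← hone, e3]
  have hg2 : (dag n1 + dag n1) ≫ n1 = 𝟙 A := by
    apply hom_ext_generator
    intro x
    have hy : (x ≫ i + (ε ≫ x) ≫ j) ≫ (dag i + dag j) = 0 := by
      simp only [hom_add_comp, hom_comp_add, Category.assoc, hi, hj, hij, hji, comp_zero, add_zero,
        zero_add, Category.comp_id]
      calc x + ε ≫ x = (ε + 𝟙 K) ≫ x := by rw [hom_add_comp, Category.id_comp, add_comm]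
        _ = 0 := by rw [hε, zero_comp]
    have hy2 := hu _ hy
    generalize (x ≫ i + (ε ≫ x) ≫ j) ≫ dag n = y at hy2
    have hx : x = y ≫ n1 := by
      rw [← hn1, ← Category.assoc, ← hy2, hom_add_comp, Category.assoc, Category.assoc, hi, hji]
      simp
    rw [hx, Category.comp_id, Category.assoc, ← Category.assoc n1, hg1, Category.id_comp]
  refine ⟨(dag n1 + dag n1) ≫ n2, ?_⟩
  rw [← hg2, ← hom_comp_add, add_comm n2, hsum, comp_zero]

end Semiadditive

variable {C : Type u} [Category.{v} C] [HilbertCategory C]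

/-- Morphisms form an abelian group under `homAdd`. -/
noncomputable instance homAddCommGroup (A B : C) : AddCommGroup (A ⟶ B) where
  __ := homAddCommMonoid A B
  neg f := (exists_neg_one A).choose ≫ f
  zsmul := letI : Add (A ⟶ B) := ⟨homAdd⟩; letI : Zero (A ⟶ B) := ⟨0⟩
    letI : Neg (A ⟶ B) := ⟨fun f => (exists_neg_one A).choose ≫ f⟩; zsmulRec
  neg_add_cancel f := by
    change homAdd ((exists_neg_one A).choose ≫ f) f = 0
    have h := homAdd_comp (exists_neg_one A).choose (𝟙 A) f
    rw [Category.id_comp] at h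
    rw [← h]
    exact (congrArg (· ≫ f) (exists_neg_one A).choose_spec).trans zero_comp

noncomputable instance : Preadditive C where
  add_comp _ _ _ := hom_add_comp
  comp_add _ _ _ := hom_comp_add

end HilbertCategory

namespace HilbertCategory

variable {C : Type u} [Category.{v} C] [HilbertCategory C]

/-! ### The dagger as an additive map -/

/-- The dagger as an additive homomorphism. -/
noncomputable def dagHom (A B : C) : (A ⟶ B) →+ (B ⟶ A) where
  toFun := dag
  map_zero' := dag_zero A B
  map_add' := dag_add

theorem dag_sub {A B : C} (f g : A ⟶ B) : dag (f - g) = dag f - dag g :=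
  map_sub (dagHom A B) f g

theorem dag_sum {A B : C} {ι : Type*} (s : Finset ι) (f : ι → (A ⟶ B)) :
    dag (∑ i ∈ s, f i) = ∑ i ∈ s, dag (f i) :=
  map_sum (dagHom A B) f s

theorem daggerMono_comp {A B D : C} {f : A ⟶ B} {g : B ⟶ D} (hf : IsDaggerMono f)
    (hg : IsDaggerMono g) : IsDaggerMono (f ≫ g) :=
  (daggerMono C).comp_mem f g hf hg

/-! ### Positive scalars -/

/-- A scalar is positive when it is `x† ∘ x` for a vector `x` of some object. -/
def IsPos (a : (K : C) ⟶ K) : Prop := ∃ (A : C) (x : K ⟶ A), x ≫ dag x = a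

theorem isPos_self {A : C} (x : K ⟶ A) : IsPos (x ≫ dag x) := ⟨A, x, rfl⟩

theorem isPos_zero : IsPos (0 : (K : C) ⟶ K) := ⟨K, 0, by simp⟩

theorem IsPos.add {a b : (K : C) ⟶ K} (ha : IsPos a) (hb : IsPos b) : IsPos (a + b) := by
  obtain ⟨A, x, rfl⟩ := ha
  obtain ⟨B, y, rfl⟩ := hb
  obtain ⟨P, i, j, hi, hj, hij, hji, hs⟩ := exists_orthogonal_sum A B
  refine ⟨P, x ≫ i + y ≫ j, ?_⟩
  simp only [dag_add, dag_comp, Preadditive.add_comp, Preadditive.comp_add, Category.assoc,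
    reassoc_of% hi, reassoc_of% hj, reassoc_of% hij, reassoc_of% hji, zero_comp, comp_zero,
    add_zero, zero_add]

theorem IsPos.conj {a : (K : C) ⟶ K} (ha : IsPos a) (c : (K : C) ⟶ K) :
    IsPos (c ≫ a ≫ dag c) := by
  obtain ⟨A, x, rfl⟩ := ha
  exact ⟨A, c ≫ x, by rw [dag_comp, Category.assoc, Category.assoc]⟩

/-- The cone of positive scalars is salient: if `x† x + y† y = 0`, then the vector `(x, y)` of the
orthogonal sum is zero. -/
theorem IsPos.eq_zero_of_add_eq_zero {a b : (K : C) ⟶ K} (ha : IsPos a) (hb : IsPos b)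
    (h : a + b = 0) : a = 0 := by
  obtain ⟨A, x, rfl⟩ := ha
  obtain ⟨B, y, rfl⟩ := hb
  obtain ⟨P, i, j, hi, hj, hij, hji, hs⟩ := exists_orthogonal_sum A B
  have h1 : x ≫ i + y ≫ j = 0 := by
    apply eq_zero_of_comp_dag_eq_zero
    rw [← h]
    simp only [dag_add, dag_comp, Preadditive.add_comp, Preadditive.comp_add, Category.assoc,
      reassoc_of% hi, reassoc_of% hj, reassoc_of% hij, reassoc_of% hji, zero_comp, comp_zero,
      add_zero, zero_add]
  have h2 : x = 0 := by
    have := congrArg (· ≫ dag i) h1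
    simpa only [Preadditive.add_comp, Category.assoc, hi, hji, comp_zero, add_zero, zero_comp,
      Category.comp_id] using this
  rw [h2, zero_comp]

/-- Bessel's inequality for a dagger subobject. -/
theorem isPos_sub_of_daggerMono {A M : C} {m : M ⟶ A} (hm : IsDaggerMono m) (x : K ⟶ A) :
    IsPos (x ≫ dag x - (x ≫ dag m) ≫ dag (x ≫ dag m)) := by
  obtain ⟨N, n, hn, hnm, hmn, hs⟩ := exists_complement m hm
  refine ⟨N, x ≫ dag n, ?_⟩
  rw [eq_sub_iff_add_eq]
  simp only [dag_comp, dag_dag, Category.assoc]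
  rw [← Preadditive.comp_add, ← Category.assoc (dag n), ← Category.assoc (dag m),
    ← Preadditive.add_comp, add_comm, hs, Category.id_comp]

/-- The norm `x† ∘ x` of a vector is attained by a vector `y` spanning its object `B`: `y` is
invertible, or zero with `B` a zero object. The morphism `z` is the inverse of `y`, if there is one,
and zero otherwise. -/
theorem exists_spanning_vector {A : C} (x : K ⟶ A) : ∃ (B : C) (y : K ⟶ B) (z : B ⟶ K),
    y ≫ dag y = x ≫ dag x ∧ z ≫ y = 𝟙 B ∧
      ∀ {T : C} (w : K ⟶ T), w ≫ dag w = x ≫ dag x → y ≫ z ≫ w = w := by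
  by_cases hx : x = 0
  · refine ⟨(HasZeroObject.zero' C).zero, 0, 0, by simp [hx], (isZero_zero C).eq_of_src _ _,
      fun w hw => ?_⟩
    rw [hx, zero_comp] at hw
    rw [eq_zero_of_comp_dag_eq_zero hw]
    simp
  obtain ⟨N, n, hn, hnx, hu⟩ := exists_daggerKernel (dag x)
  obtain ⟨M, m, hm, hmn, hnm, hs⟩ := exists_complement n hn
  have hxn : x ≫ dag n = 0 := by
    have := congrArg dag hnx
    rwa [dag_comp, dag_dag, dag_zero] at this
  have hym : x = (x ≫ dag m) ≫ m := by
    conv_lhs => rw [← Category.comp_id x, ← hs]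
    rw [Preadditive.comp_add, ← Category.assoc, hxn, zero_comp, zero_add, Category.assoc]
  generalize hy : x ≫ dag m = y at hym
  have hyy : y ≫ dag y = x ≫ dag x := by
    rw [hym, dag_comp, Category.assoc, ← Category.assoc m, hm, Category.id_comp]
  have hne : y ≫ dag y ≠ 0 := fun h => hx (eq_zero_of_comp_dag_eq_zero (hyy ▸ h))
  have := isIso_scalar hne
  have hyz : y ≫ dag y ≫ inv (y ≫ dag y) = 𝟙 K := by
    rw [← Category.assoc, IsIso.hom_inv_id]
  refine ⟨M, y, dag y ≫ inv (y ≫ dag y), hyy, ?_, fun w _ => ?_⟩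
  · apply hom_ext_generator
    intro t
    rw [Category.comp_id, ← sub_eq_zero]
    generalize hd : t ≫ (dag y ≫ inv (y ≫ dag y)) ≫ y - t = d
    have h1 : d ≫ dag y = 0 := by
      rw [← hd, Preadditive.sub_comp]
      simp only [Category.assoc]
      rw [IsIso.inv_hom_id, Category.comp_id, sub_self]
    have h2 : (d ≫ m) ≫ dag x = 0 := by
      rw [hym, dag_comp, Category.assoc, ← Category.assoc m, hm, Category.id_comp, h1]
    have h3 := hu _ h2
    rw [Category.assoc d, hmn, comp_zero, zero_comp] at h3
    rw [← Category.comp_id d, ← hm, ← Category.assoc, h3, zero_comp]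
  · rw [← Category.assoc y, hyz, Category.id_comp]

/-! ### Directed colimits of dagger monomorphisms -/

section Colimits

variable {J : Type v} [PartialOrder J]

/-- `π` is a colimit cocone in the category of dagger monomorphisms which is moreover jointly epic
in the whole category. -/
structure IsDaggerColimit (F : J ⥤ C) {Z : C} (π : ∀ i, F.obj i ⟶ Z) : Prop where
  mono : ∀ i, IsDaggerMono (π i)
  comp : ∀ {i j} (h : i ⟶ j), F.map h ≫ π j = π i
  exists_desc : ∀ {Y : C} (g : ∀ i, F.obj i ⟶ Y), (∀ i, IsDaggerMono (g i)) →
    (∀ {i j} (h : i ⟶ j), F.map h ≫ g j = g i) → ∃ u : Z ⟶ Y, IsDaggerMono u ∧ ∀ i, π i ≫ u = g i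
  hom_ext : ∀ {Y : C} (g h : Z ⟶ Y), (∀ i, π i ≫ g = π i ≫ h) → g = h

variable [IsDirectedOrder J] [Nonempty J]

/-- The colimit cocone is jointly epic: the dagger equalizer of two morphisms which agree on it
receives a compatible cocone, so it is everything. -/
theorem exists_daggerColimit (F : J ⥤ C) (hF : ∀ {i j} (h : i ⟶ j), IsDaggerMono (F.map h)) :
    ∃ (Z : C) (π : ∀ i, F.obj i ⟶ Z), IsDaggerColimit F π := by
  have := hasDirectedColimits (C := C) J
  let Fw : J ⥤ WideSubcategory (daggerMono C) :=
    { obj := fun i => ⟨F.obj i⟩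
      map := fun h => ⟨F.map h, hF h⟩
      map_id := fun i => by ext; exact F.map_id i
      map_comp := fun f g => by ext; exact F.map_comp f g }
  let Z : C := (colimit Fw).obj
  let π : ∀ i, F.obj i ⟶ Z := fun i => (colimit.ι Fw i).hom
  have hmono : ∀ i, IsDaggerMono (π i) := fun i => (colimit.ι Fw i).property
  have hcomp : ∀ {i j} (h : i ⟶ j), F.map h ≫ π j = π i := fun h =>
    congrArg (fun t => t.hom) (colimit.w Fw h)
  have hdesc : ∀ {Y : C} (g : ∀ i, F.obj i ⟶ Y), (∀ i, IsDaggerMono (g i)) →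
      (∀ {i j} (h : i ⟶ j), F.map h ≫ g j = g i) →
      ∃ u : Z ⟶ Y, IsDaggerMono u ∧ ∀ i, π i ≫ u = g i := by
    intro Y g hg hgc
    let c : Cocone Fw :=
      { pt := ⟨Y⟩
        ι := { app := fun i => ⟨g i, hg i⟩
               naturality := fun i j h => by
                ext
                exact (hgc h).trans (Category.comp_id _).symm } }
    exact ⟨(colimit.desc Fw c).hom, (colimit.desc Fw c).property, fun i =>
      congrArg (fun t => t.hom) (colimit.ι_desc c i)⟩
  refine ⟨Z, π, hmono, hcomp, hdesc, fun {Y} g h hgh => ?_⟩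
  obtain ⟨E, e, w, he, ⟨hl⟩⟩ := exists_daggerEqualizer g h
  have he' : e ≫ dag e = 𝟙 E := he
  have hk : ∀ i, ∃ k : F.obj i ⟶ E, k ≫ e = π i := fun i =>
    ⟨_, (Fork.IsLimit.lift' hl (π i) (hgh i)).2⟩
  choose k hk using hk
  have hk' : ∀ i, k i = π i ≫ dag e := fun i => by
    rw [← hk, Category.assoc, he', Category.comp_id]
  obtain ⟨t, ht, htk⟩ := hdesc k
    (fun i => by
      have := hmono i
      rwa [IsDaggerMono, ← hk i, dag_comp, Category.assoc, ← Category.assoc e, he',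
        Category.id_comp] at this)
    (fun f => by rw [hk', hk', ← Category.assoc, hcomp])
  have hid : t ≫ e = 𝟙 Z := by
    have h1 : (⟨t ≫ e, daggerMono_comp ht he⟩ : colimit Fw ⟶ colimit Fw) = 𝟙 (colimit Fw) := by
      refine colimit.hom_ext (F := Fw) fun i => ?_
      ext
      change π i ≫ t ≫ e = π i ≫ 𝟙 Z
      rw [← Category.assoc, htk, hk, Category.comp_id]
    exact congrArg (fun t => t.hom) h1
  rw [← Category.id_comp g, ← hid, Category.assoc, w, ← Category.assoc, hid, Category.id_comp]

/-- A compatible cocone of dagger monomorphisms which is jointly epic is a colimit. -/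
theorem isDaggerColimit_of_hom_ext (F : J ⥤ C) (hF : ∀ {i j} (h : i ⟶ j), IsDaggerMono (F.map h))
    {A : C} (m : ∀ i, F.obj i ⟶ A) (hm : ∀ i, IsDaggerMono (m i))
    (hc : ∀ {i j} (h : i ⟶ j), F.map h ≫ m j = m i)
    (hext : ∀ g : A ⟶ A, (∀ i, m i ≫ g = m i) → g = 𝟙 A) :
    IsDaggerColimit F m := by
  obtain ⟨Z, π, hπ⟩ := exists_daggerColimit F hF
  obtain ⟨t, ht, htm⟩ := hπ.exists_desc m hm hc
  have ht1 : t ≫ dag t = 𝟙 Z := ht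
  have ht2 : dag t ≫ t = 𝟙 A := by
    apply hext
    intro i
    rw [← htm, Category.assoc, ← Category.assoc t, ht1, Category.id_comp]
  refine ⟨hm, hc, fun {Y} g hg hgc => ?_, fun {Y} g h hgh => ?_⟩
  · obtain ⟨s, hs, hsg⟩ := hπ.exists_desc g hg hgc
    refine ⟨dag t ≫ s, daggerMono_comp ?_ hs, fun i => ?_⟩
    · rw [IsDaggerMono, dag_dag, ht2]
    · rw [← htm, Category.assoc, ← Category.assoc t, ht1, Category.id_comp, hsg]
  · have h1 : t ≫ g = t ≫ h := hπ.hom_ext _ _ fun i => by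
      rw [← Category.assoc, ← Category.assoc, htm, hgh]
    rw [← Category.id_comp g, ← ht2, Category.assoc, h1, ← Category.assoc, ht2, Category.id_comp]

/-- A bounded compatible family of vectors `p i` of a directed system of dagger monomorphisms comes
from a vector `q` of the colimit, which obeys the same bound. The vector `q` is the projection to
the colimit of a vector of the larger directed system `F i ⊕ B i`, in which a vector `y i` of `B i`
with norm `b - p i† p i` makes up for the missing norm of `p i`. -/
theorem IsDaggerColimit.exists_vector {F : J ⥤ C}
    (hF : ∀ {i j} (h : i ⟶ j), IsDaggerMono (F.map h)) {Z : C} {π : ∀ i, F.obj i ⟶ Z}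
    (hπ : IsDaggerColimit F π) (p : ∀ i, K ⟶ F.obj i)
    (hp : ∀ {i j} (h : i ⟶ j), p j ≫ dag (F.map h) = p i) (b : (K : C) ⟶ K)
    (hb : ∀ i, IsPos (b - p i ≫ dag (p i))) :
    ∃ q : K ⟶ Z, (∀ i, q ≫ dag (π i) = p i) ∧ IsPos (b - q ≫ dag q) := by
  have h1 : ∀ i, ∃ (B : C) (y : K ⟶ B) (z : B ⟶ K), y ≫ dag y = b - p i ≫ dag (p i) ∧
      z ≫ y = 𝟙 B ∧
      ∀ {T : C} (w : K ⟶ T), w ≫ dag w = b - p i ≫ dag (p i) → y ≫ z ≫ w = w := by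
    intro i
    obtain ⟨A, x, hx⟩ := hb i
    rw [← hx]
    exact exists_spanning_vector x
  choose B y z hy hzy hyz using h1
  have h2 := fun i => exists_orthogonal_sum (F.obj i) (B i)
  choose S α β hα hβ hαβ hβα hs using h2
  have hF' : ∀ {i j} (h : i ⟶ j), F.map h ≫ dag (F.map h) = 𝟙 _ := fun h => hF h
  -- The image of `y i` in `F j ⊕ B j`.
  let w : ∀ {i j}, (i ⟶ j) → (K ⟶ S j) := fun {i j} h =>
    (p j - p i ≫ F.map h) ≫ α j + y j ≫ β j
  have hrF : ∀ {i j} (h : i ⟶ j), (p j - p i ≫ F.map h) ≫ dag (F.map h) = 0 := fun {i j} h => by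
    rw [Preadditive.sub_comp, hp, Category.assoc, hF', Category.comp_id, sub_self]
  have hww : ∀ {i j} (h : i ⟶ j), w h ≫ dag (w h) = b - p i ≫ dag (p i) := fun {i j} h => by
    have e1 : w h ≫ dag (w h) = (p j - p i ≫ F.map h) ≫ dag (p j - p i ≫ F.map h)
        + y j ≫ dag (y j) := by
      simp only [w, dag_add, dag_comp, Preadditive.add_comp, Preadditive.comp_add, Category.assoc,
        reassoc_of% (hα j), reassoc_of% (hβ j), reassoc_of% (hαβ j), reassoc_of% (hβα j),
        zero_comp, comp_zero, add_zero, zero_add]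
    have e2 : (p j - p i ≫ F.map h) ≫ dag (p j - p i ≫ F.map h) =
        p j ≫ dag (p j) - p i ≫ dag (p i) := by
      rw [dag_sub, Preadditive.comp_sub, dag_comp, ← Category.assoc _ (dag (F.map h)), hrF,
        zero_comp, sub_zero, Preadditive.sub_comp, Category.assoc, ← hp h, dag_comp, dag_dag]
    rw [e1, e2, hy]
    abel
  have hwF : ∀ {i j} (h : i ⟶ j), F.map h ≫ α j ≫ dag (w h) = 0 := fun {i j} h => by
    have e1 : α j ≫ dag (w h) = dag (p j - p i ≫ F.map h) := by
      simp only [w, dag_add, dag_comp, Preadditive.comp_add, reassoc_of% (hα j),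
        reassoc_of% (hαβ j), zero_comp, add_zero]
    rw [e1, ← dag_dag (F.map h), ← dag_comp, dag_dag, hrF, dag_zero]
  have hwF' : ∀ {i j} (h : i ⟶ j), w h ≫ dag (α j) ≫ dag (F.map h) = 0 := fun {i j} h => by
    have := congrArg dag (hwF h)
    simpa only [dag_comp, dag_dag, dag_zero, Category.assoc] using this
  have hwy : ∀ {i j} (h : i ⟶ j), y i ≫ z i ≫ w h = w h := fun h => hyz _ _ (hww h)
  -- The transition morphism is `F h` on `F i` and takes `y i` to `w h`, which has the same norm and
  -- is orthogonal to the image of `F i`.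
  let G : J ⥤ C :=
    { obj := S
      map := fun {i j} h => dag (α i) ≫ F.map h ≫ α j + dag (β i) ≫ z i ≫ w h
      map_id := fun i => by
        simp only [w, F.map_id, Category.comp_id, Category.id_comp, sub_self, zero_comp, zero_add,
          reassoc_of% (hzy i), hs]
      map_comp := fun {i j k} f g => by
        have e1 : w f ≫ (dag (α j) ≫ F.map g ≫ α k + dag (β j) ≫ z j ≫ w g) = w (f ≫ g) := by
          have : w f ≫ (dag (α j) ≫ F.map g ≫ α k + dag (β j) ≫ z j ≫ w g) =
              (p j - p i ≫ F.map f) ≫ F.map g ≫ α k + y j ≫ z j ≫ w g := by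
            simp only [w, Preadditive.add_comp, Preadditive.comp_add, Category.assoc,
              reassoc_of% (hα j), reassoc_of% (hβ j), reassoc_of% (hαβ j), reassoc_of% (hβα j),
              zero_comp, comp_zero, add_zero, zero_add]
          rw [this, hwy]
          simp only [w, F.map_comp, Preadditive.sub_comp, Category.assoc]
          abel
        rw [Preadditive.add_comp]
        simp only [Category.assoc, e1]
        congr 1
        simp only [Preadditive.comp_add, reassoc_of% (hα j), reassoc_of% (hαβ j), zero_comp,
          add_zero, F.map_comp, Category.assoc] }
  have hG : ∀ {i j} (h : i ⟶ j), G.map h = dag (α i) ≫ F.map h ≫ α j + dag (β i) ≫ z i ≫ w h :=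
    fun h => rfl
  have hGm : ∀ {i j} (h : i ⟶ j), IsDaggerMono (G.map h) := fun {i j} h => by
    have e1 : z i ≫ w h ≫ dag (w h) ≫ dag (z i) = 𝟙 (B i) := by
      have : w h ≫ dag (w h) = y i ≫ dag (y i) := by rw [hww, hy]
      rw [reassoc_of% this, reassoc_of% (hzy i), ← dag_comp, hzy, dag_id]
    have e2 : z i ≫ w h ≫ dag (w h) ≫ dag (z i) ≫ β i = β i := by
      have := congrArg (· ≫ β i) e1
      simpa only [Category.assoc, Category.id_comp] using this
    rw [IsDaggerMono, hG, ← hs i]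
    simp only [dag_add, dag_comp, dag_dag, Preadditive.add_comp, Preadditive.comp_add,
      Category.assoc, reassoc_of% (hα j), reassoc_of% (hF' h), reassoc_of% (hwF h),
      reassoc_of% (hwF' h), e2, zero_comp, comp_zero, add_zero, zero_add]
  obtain ⟨Y, ρ, hρ⟩ := exists_daggerColimit G hGm
  -- The vectors `(p i, y i)` of norm `b` form a compatible family for `G`.
  let s : ∀ i, K ⟶ G.obj i := fun i => p i ≫ α i + y i ≫ β i
  have hsG : ∀ {i j} (h : i ⟶ j), s i ≫ G.map h = s j := fun {i j} h => by
    have : s i ≫ G.map h = p i ≫ F.map h ≫ α j + y i ≫ z i ≫ w h := by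
      rw [hG]
      simp only [s, Preadditive.add_comp, Preadditive.comp_add, Category.assoc,
        reassoc_of% (hα i), reassoc_of% (hβ i), reassoc_of% (hαβ i), reassoc_of% (hβα i),
        zero_comp, comp_zero, add_zero, zero_add]
    rw [this, hwy]
    simp only [w, s, Preadditive.sub_comp, Category.assoc]
    abel
  have hss : ∀ i, s i ≫ dag (s i) = b := fun i => by
    have : s i ≫ dag (s i) = p i ≫ dag (p i) + y i ≫ dag (y i) := by
      simp only [s, dag_add, dag_comp, Preadditive.add_comp, Preadditive.comp_add, Category.assoc,
        reassoc_of% (hα i), reassoc_of% (hβ i), reassoc_of% (hαβ i), reassoc_of% (hβα i),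
        zero_comp, comp_zero, add_zero, zero_add]
    rw [this, hy]
    abel
  obtain ⟨i₀⟩ := ‹Nonempty J›
  -- All of them have the same image in the colimit `Y` of `G`, and `Z` embeds in `Y` by `t`.
  have hx : ∀ i, s i ≫ ρ i = s i₀ ≫ ρ i₀ := fun i => by
    obtain ⟨k, hik, hk⟩ := exists_ge_ge i i₀
    rw [← hρ.comp (homOfLE hik), ← hρ.comp (homOfLE hk), ← Category.assoc, ← Category.assoc,
      hsG, hsG]
  have hρ' : ∀ i, ρ i ≫ dag (ρ i) = 𝟙 _ := hρ.mono
  obtain ⟨t, ht, htρ⟩ := hπ.exists_desc (fun i => α i ≫ ρ i)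
    (fun i => daggerMono_comp (hα i) (hρ.mono i))
    (fun {i j} h => by
      rw [← hρ.comp h, hG]
      simp only [Preadditive.comp_add, Preadditive.add_comp, Category.assoc, reassoc_of% (hα i),
        reassoc_of% (hαβ i), zero_comp, add_zero])
  refine ⟨(s i₀ ≫ ρ i₀) ≫ dag t, fun i => ?_, ?_⟩
  · rw [← hx i, Category.assoc, ← dag_comp, htρ, dag_comp, Category.assoc, reassoc_of% (hρ' i)]
    simp only [s, Preadditive.add_comp, Category.assoc, hα, hβα, comp_zero, add_zero,
      Category.comp_id]
  · have h3 := isPos_sub_of_daggerMono ht (s i₀ ≫ ρ i₀)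
    have h4 : (s i₀ ≫ ρ i₀) ≫ dag (s i₀ ≫ ρ i₀) = b := by
      rw [dag_comp, Category.assoc, reassoc_of% (hρ' i₀), hss]
    rwa [h4] at h3

end Colimits

/-! ### Suprema of bounded increasing sequences of positive scalars -/

/-- An increasing sequence of positive scalars consists of the norms of the projections `p n` of one
vector to an increasing sequence of objects: `F (n + 1)` is the orthogonal sum of `F n` and an
object with a vector of norm `a (n + 1) - a n`. -/
theorem exists_vector_sequence (a : ℕ → ((K : C) ⟶ K)) (h0 : IsPos (a 0))
    (hs : ∀ n, IsPos (a (n + 1) - a n)) :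
    ∃ (F : ℕ ⥤ C) (p : ∀ n, K ⟶ F.obj n), (∀ {i j} (h : i ⟶ j), IsDaggerMono (F.map h)) ∧
      (∀ {i j} (h : i ⟶ j), p j ≫ dag (F.map h) = p i) ∧ ∀ n, p n ≫ dag (p n) = a n := by
  have step : ∀ (n : ℕ) (P : C) (p : K ⟶ P), p ≫ dag p = a n →
      ∃ (Q : C) (q : K ⟶ Q) (i : P ⟶ Q), q ≫ dag q = a (n + 1) ∧ i ≫ dag i = 𝟙 P ∧
        q ≫ dag i = p := by
    intro n P p hp
    obtain ⟨A, x, hx⟩ := hs n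
    obtain ⟨Q, i, j, hi, hj, hij, hji, -⟩ := exists_orthogonal_sum P A
    refine ⟨Q, p ≫ i + x ≫ j, i, ?_, hi, ?_⟩
    · have : (p ≫ i + x ≫ j) ≫ dag (p ≫ i + x ≫ j) = p ≫ dag p + x ≫ dag x := by
        simp only [dag_add, dag_comp, Preadditive.add_comp, Preadditive.comp_add, Category.assoc,
          reassoc_of% hi, reassoc_of% hj, reassoc_of% hij, reassoc_of% hji, zero_comp, comp_zero,
          add_zero, zero_add]
      rw [this, hp, hx]
      abel
    · simp only [Preadditive.add_comp, Category.assoc, hi, hji, comp_zero, add_zero,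
        Category.comp_id]
  choose Q q i hq hi hqi using step
  obtain ⟨A, x, hx⟩ := h0
  let R : ∀ n, { P : Σ A : C, K ⟶ A // P.2 ≫ dag P.2 = a n } := fun n =>
    Nat.rec ⟨⟨A, x⟩, hx⟩ (fun n P => ⟨⟨_, q n P.1.1 P.1.2 P.2⟩, hq n P.1.1 P.1.2 P.2⟩) n
  let f : ∀ n, (R n).1.1 ⟶ (R (n + 1)).1.1 := fun n => i n _ _ (R n).2
  let F : ℕ ⥤ C := Functor.ofSequence f
  have key : ∀ i j : ℕ, ∀ h : i ≤ j, IsDaggerMono (F.map (homOfLE h)) ∧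
      (R j).1.2 ≫ dag (F.map (homOfLE h)) = (R i).1.2 := by
    intro i j h
    induction j, h using Nat.le_induction with
    | base =>
      have : F.map (homOfLE (le_refl i)) = 𝟙 _ := F.map_id i
      rw [this, IsDaggerMono, dag_id]
      exact ⟨Category.comp_id _,
        (congrArg ((R i).1.2 ≫ ·) (dag_id (R i).1.1)).trans (Category.comp_id (R i).1.2)⟩
    | succ j h ih =>
      have e1 : F.map (homOfLE (h.trans (Nat.le_succ j))) = F.map (homOfLE h) ≫ f j := by
        rw [← homOfLE_comp h (Nat.le_succ j), F.map_comp]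
        congr 1
        exact Functor.ofSequence_map_homOfLE_succ f j
      have e2 : (R (j + 1)).1.2 ≫ dag (f j) = (R j).1.2 := hqi j _ _ (R j).2
      rw [e1]
      exact ⟨daggerMono_comp ih.1 (hi _ _ _ _),
        (congrArg ((R (j + 1)).1.2 ≫ ·) (dag_comp (F.map (homOfLE h)) (f j))).trans
          ((Category.assoc _ _ _).symm.trans
            ((congrArg (· ≫ dag (F.map (homOfLE h))) e2).trans ih.2))⟩
  exact ⟨F, fun n => (R n).1.2, fun {i j} h => (key i j (leOfHom h)).1,
    fun {i j} h => (key i j (leOfHom h)).2, fun n => (R n).2⟩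

/-- Positive scalars are monotone sequentially complete. The supremum is the norm of a vector of
the colimit of the objects spanned by the increments. -/
theorem exists_isLUB_of_isPos (a : ℕ → ((K : C) ⟶ K)) (h0 : IsPos (a 0))
    (hs : ∀ n, IsPos (a (n + 1) - a n)) (b : (K : C) ⟶ K) (hb : ∀ n, IsPos (b - a n)) :
    ∃ s : (K : C) ⟶ K, (∀ n, IsPos (s - a n)) ∧
      ∀ b', (∀ n, IsPos (b' - a n)) → IsPos (b' - s) := by
  obtain ⟨F, p, hF, hp, ha⟩ := exists_vector_sequence a h0 hs
  -- Directed colimits are available for index sets in `Type v` only.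
  let U : ULift.{v} ℕ ⥤ ℕ := (show Monotone (ULift.down : ULift.{v} ℕ → ℕ) from
    fun _ _ h => h).functor
  obtain ⟨Z, π, hπ⟩ := exists_daggerColimit (U ⋙ F) (fun h => hF _)
  have key : ∀ b', (∀ n, IsPos (b' - a n)) → ∃ q : K ⟶ Z, (∀ i, q ≫ dag (π i) = p i.down) ∧
      IsPos (b' - q ≫ dag q) := fun b' hb' =>
    hπ.exists_vector (fun h => hF _) (fun i => p i.down) (fun h => hp _) b'
      (fun i => (ha i.down).symm ▸ hb' i.down)
  obtain ⟨q, hq, -⟩ := key b hb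
  refine ⟨q ≫ dag q, fun n => ?_, fun b' hb' => ?_⟩
  · have := isPos_sub_of_daggerMono (hπ.mono ⟨n⟩) q
    rw [hq] at this
    rw [← ha n]
    exact this
  · obtain ⟨q', hq', hb''⟩ := key b' hb'
    -- A vector of the colimit is determined by its projections.
    have : q' = q := by
      rw [← dag_dag q', ← dag_dag q]
      congr 1
      apply hπ.hom_ext
      intro i
      have e := congrArg dag ((hq' i).trans (hq i).symm)
      simpa only [dag_comp, dag_dag] using e
    rwa [this] at hb''

end HilbertCategory

/-! ### Division rings with involution and monotone completeness -/

/-- A division ring with involution and a compatible partial order, for which increasing sequences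
of positive elements that are bounded above have suprema. Positive elements are symmetric and
closed under the operations `a ↦ d* a d`; they need not be of the form `d* d`. -/
class MonotoneCompleteDivisionRing (D : Type*) [DivisionRing D] [StarRing D] [PartialOrder D] :
    Prop extends IsOrderedAddMonoid D where
  star_of_nonneg : ∀ {a : D}, 0 ≤ a → star a = a
  conj_nonneg : ∀ {a : D} (d : D), 0 ≤ a → 0 ≤ star d * a * d
  zero_le_one : (0 : D) ≤ 1
  exists_isLUB : ∀ a : ℕ → D, 0 ≤ a 0 → Monotone a → BddAbove (Set.range a) →
    ∃ s, IsLUB (Set.range a) s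

namespace MonotoneCompleteDivisionRing

variable {D : Type*} [DivisionRing D]

theorem star_two_inv [StarRing D] : star (2⁻¹ : D) = 2⁻¹ := by
  rw [star_inv₀, star_ofNat]

theorem commute_two_inv (x : D) : Commute (2⁻¹ : D) x :=
  (Nat.cast_commute 2 x).inv_left₀

theorem half_add_half [CharZero D] (x : D) : 2⁻¹ * x + 2⁻¹ * x = x := by
  rw [← two_mul, ← mul_assoc, mul_inv_cancel₀ two_ne_zero, one_mul]

variable [StarRing D] [PartialOrder D] [MonotoneCompleteDivisionRing D]

instance : ZeroLEOneClass D := ⟨zero_le_one⟩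

instance : CharZero D := charZero_of_inj_zero fun n hn => by
  by_contra h
  exact ((Nat.cast_pos' (α := D)).mpr (Nat.pos_of_ne_zero h)).ne' hn

theorem star_mul_self_nonneg' (d : D) : 0 ≤ star d * d := by
  simpa using conj_nonneg d (zero_le_one (D := D))

theorem conj_mono {a b : D} (d : D) (h : a ≤ b) : star d * a * d ≤ star d * b * d := by
  have := conj_nonneg d (sub_nonneg.mpr h)
  rwa [mul_sub, sub_mul, sub_nonneg] at this

theorem conj_nonneg_of_star_eq {a c : D} (hc : star c = c) (ha : 0 ≤ a) : 0 ≤ c * a * c := by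
  simpa [hc] using conj_nonneg c ha

theorem mul_self_nonneg_of_star_eq {c : D} (hc : star c = c) : 0 ≤ c * c := by
  simpa [hc] using star_mul_self_nonneg' c

theorem nonneg_of_add_self_nonneg {x : D} (h : 0 ≤ x + x) : 0 ≤ x := by
  have h1 := conj_nonneg_of_star_eq (star_two_inv (D := D)) h
  have h2 : x = 2⁻¹ * (x + x) * 2⁻¹ + 2⁻¹ * (x + x) * 2⁻¹ := by
    rw [mul_add, half_add_half, ← (commute_two_inv x).eq, half_add_half]
  rw [h2]
  exact add_nonneg h1 h1

theorem mul_self_le_self {u : D} (h0 : 0 ≤ u) (h1 : u ≤ 1) : u * u ≤ u := by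
  have hu := star_of_nonneg h0
  have h1' := sub_nonneg.mpr h1
  have e1 := conj_nonneg_of_star_eq hu h1'
  have e2 := conj_nonneg_of_star_eq (star_of_nonneg h1') h0
  rw [← sub_nonneg]
  convert add_nonneg e1 e2 using 1
  noncomm_ring

theorem star_sub_mul_sub_le (x y : D) :
    star (x - y) * (x - y) ≤ (star x * x + star y * y) + (star x * x + star y * y) := by
  rw [← sub_nonneg]
  convert star_mul_self_nonneg' (x + y) using 1
  simp only [star_add, star_sub]
  noncomm_ring

theorem eq_zero_of_star_mul_self_nonpos {c : D} (h : star c * c ≤ 0) : c = 0 := by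
  have := le_antisymm h (star_mul_self_nonneg' c)
  simpa using this

/-! ### Null sequences -/

/-- A sequence is null when `x n* x n` is dominated by a decreasing sequence with infimum `0`. -/
def IsNull (x : ℕ → D) : Prop :=
  ∃ ε : ℕ → D, Antitone ε ∧ IsGLB (Set.range ε) 0 ∧ ∀ n, star (x n) * x n ≤ ε n

theorem isGLB_add_zero {ε η : ℕ → D} (hε : Antitone ε) (hη : Antitone η)
    (hε0 : IsGLB (Set.range ε) 0) (hη0 : IsGLB (Set.range η) 0) :
    IsGLB (Set.range (ε + η)) 0 := by
  refine ⟨?_, fun l hl => ?_⟩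
  · rintro _ ⟨n, rfl⟩
    exact add_nonneg (hε0.1 ⟨n, rfl⟩) (hη0.1 ⟨n, rfl⟩)
  · apply hη0.2
    rintro _ ⟨n, rfl⟩
    rw [← sub_nonpos]
    apply hε0.2
    rintro _ ⟨m, rfl⟩
    rw [sub_le_iff_le_add]
    exact (hl ⟨max m n, rfl⟩).trans
      (add_le_add (hε (le_max_left m n)) (hη (le_max_right m n)))

theorem IsNull.sub {x y : ℕ → D} (hx : IsNull x) (hy : IsNull y) :
    IsNull (fun n => x n - y n) := by
  obtain ⟨ε, h1, h2, h3⟩ := hx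
  obtain ⟨η, k1, k2, k3⟩ := hy
  have m := h1.add k1
  have g := isGLB_add_zero h1 k1 h2 k2
  refine ⟨(ε + η) + (ε + η), m.add m, isGLB_add_zero m m g g, fun n => ?_⟩
  exact (star_sub_mul_sub_le _ _).trans
    (add_le_add (add_le_add (h3 n) (k3 n)) (add_le_add (h3 n) (k3 n)))

theorem IsNull.mul_right {x : ℕ → D} (hx : IsNull x) (d : D) : IsNull (fun n => x n * d) := by
  obtain ⟨ε, h1, h2, h3⟩ := hx
  refine ⟨fun n => star d * ε n * d, fun m n h => conj_mono d (h1 h), ⟨?_, fun l hl => ?_⟩,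
    fun n => ?_⟩
  · rintro _ ⟨n, rfl⟩
    exact conj_nonneg d (h2.1 ⟨n, rfl⟩)
  · by_cases hd : d = 0
    · simpa [hd] using hl ⟨0, rfl⟩
    have h4 : star d⁻¹ * l * d⁻¹ ≤ 0 := by
      apply h2.2
      rintro _ ⟨n, rfl⟩
      have h5 := conj_mono d⁻¹ (hl ⟨n, rfl⟩)
      have h6 : star d⁻¹ * (star d * ε n * d) * d⁻¹ = ε n := by
        rw [mul_assoc, mul_assoc, mul_assoc, mul_inv_cancel₀ hd, mul_one, ← mul_assoc, ← star_mul,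
          mul_inv_cancel₀ hd, star_one, one_mul]
      rwa [h6] at h5
    have h5 := conj_mono d h4
    have h6 : star d * (star d⁻¹ * l * d⁻¹) * d = l := by
      rw [mul_assoc, mul_assoc, mul_assoc, inv_mul_cancel₀ hd, mul_one, ← mul_assoc, ← star_mul,
        inv_mul_cancel₀ hd, star_one, one_mul]
    rwa [h6, mul_zero, zero_mul] at h5
  · have := conj_mono d (h3 n)
    simpa only [star_mul, mul_assoc] using this

theorem IsNull.mul_left {x u : ℕ → D} (hx : IsNull x) (hu : ∀ n, star (u n) * u n ≤ 1) :
    IsNull (fun n => u n * x n) := by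
  obtain ⟨ε, h1, h2, h3⟩ := hx
  refine ⟨ε, h1, h2, fun n => ?_⟩
  have := conj_mono (x n) (hu n)
  rw [mul_one] at this
  refine le_trans (le_of_eq ?_) (this.trans (h3 n))
  rw [star_mul, mul_assoc, mul_assoc, mul_assoc]

set_option linter.unusedSectionVars false in
theorem IsNull.succ {x : ℕ → D} (hx : IsNull x) : IsNull (fun n => x (n + 1)) := by
  obtain ⟨ε, h1, h2, h3⟩ := hx
  exact ⟨ε, h1, h2, fun n => (h3 _).trans (h1 (Nat.le_succ n))⟩

theorem IsNull.eq_zero {c : D} (h : IsNull fun _ => c) : c = 0 := by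
  obtain ⟨ε, -, h2, h3⟩ := h
  apply eq_zero_of_star_mul_self_nonpos
  apply h2.2
  rintro _ ⟨n, rfl⟩
  exact h3 n

/-! ### Square roots and the total order on symmetric elements -/

theorem pow_nonneg' {s : D} (hs : 0 ≤ s) : ∀ n : ℕ, 0 ≤ s ^ n
  | 0 => by simp
  | 1 => by simpa using hs
  | n + 2 => by
    have := conj_nonneg_of_star_eq (star_of_nonneg hs) (pow_nonneg' hs n)
    rwa [← pow_succ', ← pow_succ] at this

theorem aeval_nonneg {s : D} (hs : 0 ≤ s) (p : Polynomial ℕ) : 0 ≤ Polynomial.aeval s p := by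
  induction p using Polynomial.induction_on' with
  | add p q hp hq => rw [map_add]; exact add_nonneg hp hq
  | monomial n a =>
    rw [Polynomial.aeval_monomial, eq_natCast, ← nsmul_eq_mul]
    exact nsmul_nonneg (pow_nonneg' hs n) a

/-- The polynomials `W₀ = 0`, `Wₙ₊₁ = X + Wₙ²`, which at `s` increase to the smaller solution of
`w = s + w²`. -/
noncomputable def sqrtPoly : ℕ → Polynomial ℕ
  | 0 => 0
  | n + 1 => Polynomial.X + sqrtPoly n ^ 2

theorem exists_sqrtPoly_succ_eq_add (n : ℕ) :
    ∃ p, sqrtPoly (n + 1) = sqrtPoly n + p := by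
  induction n with
  | zero => exact ⟨sqrtPoly 1, by simp [sqrtPoly]⟩
  | succ n ih =>
    obtain ⟨p, hp⟩ := ih
    refine ⟨2 * sqrtPoly n * p + p ^ 2, ?_⟩
    calc Polynomial.X + sqrtPoly (n + 1) ^ 2 = Polynomial.X + (sqrtPoly n + p) ^ 2 := by rw [hp]
      _ = (Polynomial.X + sqrtPoly n ^ 2) + (2 * sqrtPoly n * p + p ^ 2) := by ring

/-- For `0 ≤ 4 s ≤ 1` the equation `w = s + w²` has a solution with `2 w ≤ 1`, which commutes with
symmetric contractions commuting with `s`; so `1 - 2 w` is a square root of `1 - 4 s`. -/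
theorem exists_quadratic_root {s : D} (hs : 0 ≤ s) (hs1 : 0 ≤ 1 - 4 * s) :
    ∃ w : D, 0 ≤ 1 - 2 * w ∧ w = s + w * w ∧
      ∀ c : D, star c = c → c * c ≤ 1 → Commute c s → Commute c w := by
  let w : ℕ → D := fun n => Polynomial.aeval s (sqrtPoly n)
  have hw0 : ∀ n, 0 ≤ w n := fun n => aeval_nonneg hs _
  have hws : ∀ n, w (n + 1) = s + w n * w n := fun n => by
    simp only [w, sqrtPoly, map_add, map_mul, Polynomial.aeval_X, sq]
  have hmono : Monotone w := monotone_nat_of_le_succ fun n => by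
    obtain ⟨p, hp⟩ := exists_sqrtPoly_succ_eq_add n
    simp only [w, hp, map_add]
    exact le_add_of_nonneg_right (aeval_nonneg hs p)
  have hle : ∀ n, 0 ≤ 1 - 2 * w n := fun n => by
    induction n with
    | zero => simp [w, sqrtPoly]
    | succ n ih =>
      have h2 : 0 ≤ 2 * w n := by rw [two_mul]; exact add_nonneg (hw0 n) (hw0 n)
      have h3 := mul_self_le_self h2 (sub_nonneg.mp ih)
      have h4 := sub_nonneg.mpr (h3.trans (sub_nonneg.mp ih))
      apply nonneg_of_add_self_nonneg
      rw [hws]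
      convert add_nonneg hs1 h4 using 1
      noncomm_ring
  have hle2 : ∀ n, w n ≤ 2⁻¹ := fun n => by
    rw [← sub_nonneg]
    apply nonneg_of_add_self_nonneg
    convert hle n using 1
    have := half_add_half (1 : D)
    rw [mul_one] at this
    rw [sub_add_sub_comm, this, two_mul]
  obtain ⟨t, ht⟩ := exists_isLUB w (hw0 0) hmono ⟨2⁻¹, by rintro _ ⟨n, rfl⟩; exact hle2 n⟩
  have hwt : ∀ n, w n ≤ t := fun n => ht.1 ⟨n, rfl⟩
  have ht0 : 0 ≤ t := (hw0 0).trans (hwt 0)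
  have ht2 : t ≤ 2⁻¹ := ht.2 (by rintro _ ⟨n, rfl⟩; exact hle2 n)
  have ht1 : t + t ≤ 1 := by
    have := half_add_half (1 : D)
    rw [mul_one] at this
    rw [← this]
    exact add_le_add ht2 ht2
  have ht1' : t ≤ 1 := (le_add_of_nonneg_left ht0).trans ht1
  let δ : ℕ → D := fun n => t - w n
  have hδ : IsNull δ := by
    refine ⟨δ, fun m n h => sub_le_sub_left (hmono h) t, ⟨?_, fun l hl => ?_⟩, fun n => ?_⟩
    · rintro _ ⟨n, rfl⟩
      exact sub_nonneg.mpr (hwt n)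
    · have : t ≤ t - l := ht.2 (by
        rintro _ ⟨n, rfl⟩
        have := hl ⟨n, rfl⟩
        exact le_sub_comm.mp this)
      simpa using this
    · have h0 : 0 ≤ δ n := sub_nonneg.mpr (hwt n)
      rw [star_of_nonneg h0]
      exact mul_self_le_self h0 ((sub_le_self t (hw0 n)).trans ht1')
  refine ⟨t, ?_, ?_, fun c hc hc1 hcs => ?_⟩
  · rwa [two_mul, sub_nonneg]
  · have hcontr : ∀ n, star (w n) * w n ≤ 1 := fun n => by
      rw [star_of_nonneg (hw0 n)]
      exact (mul_self_le_self (hw0 n) ((hwt n).trans ht1')).trans ((hwt n).trans ht1')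
    have h1 := (hδ.succ.sub (hδ.mul_right t)).sub (hδ.mul_left hcontr)
    have h2 : t - (s + t * t) = 0 := by
      apply IsNull.eq_zero
      convert h1 using 2 with n
      simp only [δ, hws]
      noncomm_ring
    exact sub_eq_zero.mp h2
  · have hcw : ∀ n, c * w n = w n * c := fun n => by
      have : ∀ p : Polynomial ℕ, Commute c (Polynomial.aeval s p) := fun p => by
        induction p using Polynomial.induction_on' with
        | add p q hp hq => rw [map_add]; exact hp.add_right hq
        | monomial n a =>
          rw [Polynomial.aeval_monomial, eq_natCast]
          exact (Nat.cast_commute a c).symm.mul_right (hcs.pow_right n)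
      exact this _
    have h1 := (hδ.mul_left (u := fun _ => c) (fun _ => by rwa [hc])).sub (hδ.mul_right c)
    have h2 : c * t - t * c = 0 := by
      apply IsNull.eq_zero
      convert h1 using 2 with n
      simp only [δ, mul_sub, sub_mul, hcw n]
      abel
    exact sub_eq_zero.mp h2

/-- A square root of `t` in the unit interval is `1 - 2 w` for the solution `w` of `w = s + w²` with
`4 s = 1 - t`. -/
theorem exists_sqrt {t : D} (h0 : 0 ≤ t) (h1 : t ≤ 1) : ∃ r : D, 0 ≤ r ∧ r * r = t ∧
    ∀ c : D, star c = c → c * c ≤ 1 → Commute c t → Commute c r := by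
  have hs4 : 4 * (2⁻¹ * (1 - t) * 2⁻¹) = 1 - t := by
    rw [← (commute_two_inv _).eq]
    have : (4 : D) = 2 * 2 := by norm_num
    rw [this, mul_assoc, ← mul_assoc 2 2⁻¹, mul_inv_cancel₀ two_ne_zero, one_mul, ← mul_assoc,
      mul_inv_cancel₀ two_ne_zero, one_mul]
  obtain ⟨w, hw1, hw2, hw3⟩ := exists_quadratic_root
    (conj_nonneg_of_star_eq (star_two_inv (D := D)) (sub_nonneg.mpr h1)) (by rw [hs4]; simpa)
  refine ⟨1 - 2 * w, hw1, ?_, fun c hc hc1 hct => ?_⟩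
  · have e1 : (1 - 2 * w) * (1 - 2 * w) = 1 - 4 * (w - w * w) := by noncomm_ring
    have e2 : w - w * w = 2⁻¹ * (1 - t) * 2⁻¹ := sub_eq_iff_eq_add.mpr hw2
    rw [e1, e2, hs4, sub_sub_cancel]
  · have e1 : Commute c (2⁻¹ : D) := (commute_two_inv c).symm
    have e2 := hw3 c hc hc1 ((e1.mul_right ((Commute.one_right c).sub_right hct)).mul_right e1)
    exact (Commute.one_right c).sub_right ((Nat.cast_commute 2 c).symm.mul_right e2)

/-- Symmetric elements are comparable with zero. With `b = (1 + a²)⁻¹`, the contraction `c = a b`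
has the same sign as `a`, and `c` is plus or minus the positive square root of `c²`. -/
theorem nonneg_or_nonpos {a : D} (ha : star a = a) : 0 ≤ a ∨ a ≤ 0 := by
  have haa := mul_self_nonneg_of_star_eq ha
  -- No bound on `a` is known here, hence the passage to the contraction `a (1 + a²)⁻¹`.
  generalize hq : 1 + a * a = q
  have hq0 : q ≠ 0 := by
    rintro rfl
    have h1 : (1 : D) ≤ 0 := by rw [← hq]; exact le_add_of_nonneg_right haa
    exact one_ne_zero (le_antisymm h1 zero_le_one)
  have hqn : 0 ≤ q := hq ▸ add_nonneg zero_le_one haa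
  have hqa : Commute a q := by
    rw [← hq]
    exact (Commute.one_right a).add_right ((Commute.refl a).mul_right (Commute.refl a))
  generalize hb : q⁻¹ = b
  have hab : Commute a b := hb ▸ hqa.inv_right₀
  have hqb : q * b = 1 := by rw [← hb, mul_inv_cancel₀ hq0]
  have hbq : b * q = 1 := by rw [← hb, inv_mul_cancel₀ hq0]
  have hbs : star b = b := by rw [← hb, star_inv₀, star_of_nonneg hqn]
  have hb0 : 0 ≤ b := by
    have := conj_nonneg_of_star_eq hbs hqn
    rwa [hbq, one_mul] at this
  have hb1 : 0 ≤ 1 - b := by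
    have h1 := conj_nonneg_of_star_eq ha hb0
    have h2 : 1 - b = a * b * a := by
      rw [mul_assoc, ← hab.eq, ← mul_assoc, ← hqb, ← hq]
      noncomm_ring
    rwa [h2]
  generalize hc : a * b = c
  have hcs : star c = c := by rw [← hc, star_mul, hbs, ha, hab.eq]
  have hcc : c * c = b - b * b := by
    calc c * c = a * a * b * b := by rw [← hc, mul_assoc a b, ← mul_assoc b, ← hab.eq]; noncomm_ring
      _ = (q * b - b) * b := by rw [← hq]; noncomm_ring
      _ = b - b * b := by rw [hqb]; noncomm_ring
  have hc1 : 0 ≤ 1 - c * c := by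
    convert add_nonneg hb1 (mul_self_nonneg_of_star_eq hbs) using 1
    rw [hcc]
    noncomm_ring
  have hc0 := mul_self_nonneg_of_star_eq hcs
  obtain ⟨r, hr0, hrr, hr⟩ := exists_sqrt hc0 (sub_nonneg.mp hc1)
  have hcr : Commute c r :=
    hr c hcs (sub_nonneg.mp hc1) ((Commute.refl c).mul_right (Commute.refl c))
  have hr2 : (r - c) * (r + c) = 0 := by
    have h1 : (r - c) * (r + c) = r * r - c * c + (r * c - c * r) := by noncomm_ring
    rw [h1, hrr, hcr.eq, sub_self, sub_self, add_zero]
  have hac : a = c + a * c * a := by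
    have : a * b * a = a * a * b := by rw [mul_assoc, ← hab.eq, mul_assoc]
    calc a = a * (q * b) := by rw [hqb, mul_one]
      _ = a * b + a * (a * a * b) := by rw [← hq]; noncomm_ring
      _ = a * b + a * (a * b * a) := by rw [this]
      _ = c + a * c * a := by rw [hc]; noncomm_ring
  -- A division ring has no zero divisors, so `c = r` or `c = -r`.
  rcases mul_eq_zero.mp hr2 with h | h
  · left
    have : 0 ≤ c := by rwa [← sub_eq_zero.mp h]
    rw [hac]
    exact add_nonneg this (conj_nonneg_of_star_eq ha this)
  · right
    have : 0 ≤ -c := by rwa [← eq_neg_of_add_eq_zero_left h]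
    rw [← neg_nonneg, hac]
    convert add_nonneg this (conj_nonneg_of_star_eq ha this) using 1
    noncomm_ring

theorem le_total_of_star_eq {a b : D} (ha : star a = a) (hb : star b = b) : a ≤ b ∨ b ≤ a := by
  have := nonneg_or_nonpos (a := b - a) (by rw [star_sub, ha, hb])
  rwa [sub_nonneg, sub_nonpos] at this

/-! ### Symmetric elements are central -/

/-- The Archimedean property: a supremum of the multiples of `k` is invariant under subtraction of
`k`. -/
theorem eq_zero_of_nsmul_le {k B : D} (hk : 0 ≤ k) (h : ∀ n : ℕ, n • k ≤ B) : k = 0 := by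
  obtain ⟨s, hs⟩ := exists_isLUB (fun n : ℕ => n • k) (by simp)
    (fun m n h => nsmul_le_nsmul_left hk h) ⟨B, by rintro _ ⟨n, rfl⟩; exact h n⟩
  have : s ≤ s - k := hs.2 (by
    rintro _ ⟨n, rfl⟩
    have := hs.1 ⟨n + 1, rfl⟩
    simp only [succ_nsmul] at this
    exact le_sub_iff_add_le.mpr this)
  exact le_antisymm (by simpa using this) hk

theorem exists_nat_ge' {a : D} (ha : star a = a) : ∃ n : ℕ, a ≤ n := by
  by_contra! h
  -- Otherwise `a` would bound every multiple of `1`.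
  have h1 : (1 : D) = 0 := eq_zero_of_nsmul_le (B := a) zero_le_one fun n => by
    rw [nsmul_one]
    exact (le_total_of_star_eq ha (star_natCast n)).resolve_left (h n)
  exact one_ne_zero h1

theorem exists_int_floor {a : D} (ha : star a = a) : ∃ m : ℤ, (m : D) ≤ a ∧ a ≤ m + 1 := by
  obtain ⟨N, hN⟩ := exists_nat_ge' ha
  obtain ⟨M, hM⟩ := exists_nat_ge' (a := -a) (by rw [star_neg, ha])
  obtain ⟨m, hm, hmax⟩ := Int.exists_greatest_of_bdd (P := fun z : ℤ => (z : D) ≤ a)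
    ⟨N, fun z hz => by
      have : (z : D) ≤ ((N : ℤ) : D) := by simpa using hz.trans hN
      exact Int.cast_le.mp this⟩
    ⟨-M, by push_cast; exact neg_le.mp hM⟩
  refine ⟨m, hm, ?_⟩
  have h1 : ¬ ((m + 1 : ℤ) : D) ≤ a := fun h => by have := hmax _ h; omega
  have h2 := (le_total_of_star_eq ha (star_intCast (m + 1))).resolve_right h1
  simpa using h2

/-- Symmetric elements are central: `n a` differs from an integer by an `r` with `0 ≤ r ≤ 1`, so
`n (a d - d a) = r d - d r` is bounded independently of `n`. -/
theorem commute_of_star_eq {a : D} (ha : star a = a) (d : D) : Commute a d := by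
  obtain ⟨N, hN⟩ := exists_nat_ge' (a := star d * d) (star_of_nonneg (star_mul_self_nonneg' d))
  have hk := star_mul_self_nonneg' (a * d - d * a)
  have key : star (a * d - d * a) * (a * d - d * a) = 0 := by
    refine eq_zero_of_nsmul_le (B := (star d * d + N) + (star d * d + N)) hk fun n => ?_
    obtain ⟨m, hm1, hm2⟩ := exists_int_floor (a := n • a) (by rw [star_nsmul, ha])
    generalize hr : n • a - (m : D) = r
    have hr0 : 0 ≤ r := hr ▸ sub_nonneg.mpr hm1
    have hr1 : r ≤ 1 := by rw [← hr]; exact sub_le_iff_le_add'.mpr hm2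
    have hrs := star_of_nonneg hr0
    have hrr : r * r ≤ 1 := (mul_self_le_self hr0 hr1).trans hr1
    have e1 : r * d - d * r = n • (a * d - d * a) := by
      have hmd : (m : D) * d = d * m := (Int.cast_commute m d).eq
      rw [← hr, sub_mul, mul_sub, hmd, smul_mul_assoc, mul_smul_comm, smul_sub]
      abel
    have e2 : star (r * d) * (r * d) ≤ star d * d := by
      have := conj_mono d hrr
      rw [mul_one] at this
      refine le_trans (le_of_eq ?_) this
      rw [star_mul, hrs]
      noncomm_ring
    have e3 : star (d * r) * (d * r) ≤ N := by
      have h1 := conj_mono r hN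
      rw [hrs, ← (Nat.cast_commute N r).eq, mul_assoc (N : D), ← nsmul_eq_mul] at h1
      have h2 : N • (r * r) ≤ N • (1 : D) := nsmul_le_nsmul_right hrr N
      rw [nsmul_one] at h2
      refine le_trans (le_of_eq ?_) (h1.trans h2)
      rw [star_mul, hrs]
      noncomm_ring
    have e4 := (star_sub_mul_sub_le (r * d) (d * r)).trans
      (add_le_add (add_le_add e2 e3) (add_le_add e2 e3))
    rw [e1, star_nsmul, smul_mul_smul_comm] at e4
    exact (nsmul_le_nsmul_left hk (Nat.le_mul_self n)).trans e4
  exact sub_eq_zero.mp (eq_zero_of_star_mul_self_nonpos key.le)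

end MonotoneCompleteDivisionRing

namespace MonotoneCompleteDivisionRing

variable {D : Type*} [DivisionRing D] [StarRing D] [PartialOrder D]
  [MonotoneCompleteDivisionRing D]

/-! ### Symmetric elements are the real numbers -/

/-- A positive multiple of `a` is the square of a symmetric element, and symmetric elements are
central, so `a b` is a positive multiple of some `r b r`. -/
theorem mul_nonneg_of_nonneg {a b : D} (ha : 0 ≤ a) (hb : 0 ≤ b) : 0 ≤ a * b := by
  obtain ⟨n, hn⟩ := exists_nat_ge' (star_of_nonneg ha)
  generalize hq : ((n + 1 : ℕ) : D) = q
  have hq0 : q ≠ 0 := hq ▸ Nat.cast_ne_zero.mpr n.succ_ne_zero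
  have haq : a ≤ q := hq ▸ hn.trans (Nat.cast_le.mpr n.le_succ)
  have hqn : 0 ≤ q := ha.trans haq
  have hqs : star q⁻¹ = q⁻¹ := by rw [star_inv₀, star_of_nonneg hqn]
  have hqc : ∀ x : D, q * x = x * q := fun x => by rw [← hq]; exact Nat.cast_commute _ x
  -- A positive multiple of `a` lies between `0` and `1`, so it is a square of a symmetric element.
  have h0 : 0 ≤ q⁻¹ * (q * a) * q⁻¹ := by
    refine conj_nonneg_of_star_eq hqs ?_
    rw [← hq, ← nsmul_eq_mul]
    exact nsmul_nonneg ha _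
  have h1 : q⁻¹ * (q * a) * q⁻¹ ≤ 1 := by
    have h2 : q * a ≤ q * q := by
      rw [← hq, ← nsmul_eq_mul, ← nsmul_eq_mul, hq]
      exact nsmul_le_nsmul_right haq _
    have h3 := conj_mono q⁻¹ h2
    rwa [hqs, ← mul_assoc q⁻¹ q q, inv_mul_cancel₀ hq0, one_mul, mul_inv_cancel₀ hq0] at h3
  obtain ⟨r, hr0, hrr, -⟩ := exists_sqrt h0 h1
  have hrs := star_of_nonneg hr0
  have e1 : q * (r * r) = a := by
    rw [hrr, ← mul_assoc q⁻¹ q a, inv_mul_cancel₀ hq0, one_mul, hqc, mul_assoc,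
      inv_mul_cancel₀ hq0, mul_one]
  have e2 : a * b = (n + 1) • (r * b * r) := by
    rw [nsmul_eq_mul, hq, ← e1, mul_assoc r b r, ← (commute_of_star_eq hrs b).eq, mul_assoc,
      mul_assoc]
  rw [e2]
  exact nsmul_nonneg (conj_nonneg_of_star_eq hrs hb) _

variable (D) in
/-- The subring of symmetric elements, which are central. -/
def symSubring : Subring D where
  carrier := {a | star a = a}
  zero_mem' := star_zero D
  one_mem' := star_one D
  add_mem' := fun {a b} ha hb => by
    change star (a + b) = a + b
    rw [star_add, ha, hb]
  neg_mem' := fun {a} ha => by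
    change star (-a) = -a
    rw [star_neg, ha]
  mul_mem' := fun {a b} ha hb => by
    change star (a * b) = a * b
    rw [star_mul, ha, hb, (commute_of_star_eq ha b).eq]

theorem isField_symSubring : IsField (symSubring D) where
  exists_pair_ne := ⟨0, 1, zero_ne_one⟩
  mul_comm a b := Subtype.ext (commute_of_star_eq a.2 b.1).eq
  mul_inv_cancel {a} ha := by
    have ha' : a.1 ≠ 0 := fun h => ha (Subtype.ext h)
    have hs : star a.1⁻¹ = a.1⁻¹ := by rw [star_inv₀, show star a.1 = a.1 from a.2]
    exact ⟨⟨a.1⁻¹, hs⟩, Subtype.ext (mul_inv_cancel₀ ha')⟩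

noncomputable instance : Field (symSubring D) := isField_symSubring.toField

noncomputable instance : LinearOrder (symSubring D) where
  __ := (inferInstance : PartialOrder (symSubring D))
  le_total a b := le_total_of_star_eq (D := D) a.2 b.2
  toDecidableLE := Classical.decRel _

instance : IsOrderedAddMonoid (symSubring D) where
  add_le_add_left _ _ h c := add_le_add_left (α := D) h c.1

instance : ZeroLEOneClass (symSubring D) := ⟨zero_le_one (D := D)⟩

instance : IsStrictOrderedRing (symSubring D) := .of_mul_pos fun _ _ ha hb =>
  lt_of_le_of_ne (mul_nonneg_of_nonneg (D := D) ha.le hb.le) (mul_ne_zero ha.ne' hb.ne').symm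

instance : Archimedean (symSubring D) := archimedean_iff_nat_le.mpr fun a => by
  obtain ⟨n, hn⟩ := exists_nat_ge' (D := D) a.2
  exact ⟨n, hn⟩

/-- The unique embedding of the Archimedean ordered field of symmetric elements in `ℝ` is onto: a
real number is the supremum of a sequence of rational numbers, which has a supremum in `D`. -/
theorem surjective_inducedMap : Function.Surjective
    (ConditionallyCompleteLinearOrderedField.inducedOrderRingHom (symSubring D) ℝ) := by
  intro x
  generalize ConditionallyCompleteLinearOrderedField.inducedOrderRingHom (symSubring D) ℝ = h
  have hmono : Monotone h := OrderHomClass.mono h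
  -- Suprema are given for sequences of positive elements, hence the shift by `u 0` below.
  obtain ⟨u, hu, hux, hut⟩ := Real.exists_seq_rat_strictMono_tendsto x
  obtain ⟨N, hN⟩ := exists_rat_gt x
  have hub : ∀ q : ℚ, x < q → ∀ n, ((u n : ℚ) : symSubring D) ≤ (q : symSubring D) :=
    fun q hq n => by
      have : ((u n : ℚ) : ℝ) ≤ q := ((hux n).trans hq).le
      exact_mod_cast this
  let a : ℕ → symSubring D := fun n => (u n : symSubring D) - (u 0 : symSubring D)
  have ham : Monotone a := fun m n hmn => by
    have : (u m : symSubring D) ≤ u n := by exact_mod_cast hu.monotone hmn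
    exact sub_le_sub_right this _
  obtain ⟨s, hs⟩ := exists_isLUB (fun n => (a n : D)) (by simp [a]) (fun m n hmn => ham hmn)
    ⟨(((N : symSubring D) - (u 0 : symSubring D) : symSubring D) : D), by
      rintro _ ⟨n, rfl⟩
      exact sub_le_sub_right (hub N hN n) (u 0 : symSubring D)⟩
  have hs0 : 0 ≤ s := (show (0 : D) ≤ a 0 by simp [a]).trans (hs.1 ⟨0, rfl⟩)
  let t : symSubring D := ⟨s, star_of_nonneg hs0⟩ + (u 0 : symSubring D)
  have h1 : ∀ n, (u n : symSubring D) ≤ t := fun n => by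
    have : a n ≤ ⟨s, star_of_nonneg hs0⟩ := hs.1 ⟨n, rfl⟩
    exact sub_le_iff_le_add.mp this
  have h2 : ∀ q : ℚ, x < q → t ≤ q := fun q hq => by
    have : (⟨s, star_of_nonneg hs0⟩ : symSubring D) ≤ (q : symSubring D) - (u 0 : symSubring D) :=
      hs.2 (by
        rintro _ ⟨n, rfl⟩
        exact sub_le_sub_right (hub q hq n) (u 0 : symSubring D))
    exact le_sub_iff_add_le.mp this
  refine ⟨t, le_antisymm ?_ ?_⟩
  · by_contra! hlt
    obtain ⟨q, hq1, hq2⟩ := exists_rat_btwn hlt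
    have := hmono (h2 q hq1)
    rw [map_ratCast] at this
    exact absurd hq2 (not_lt.mpr this)
  · refine le_of_tendsto' hut fun n => ?_
    have := hmono (h1 n)
    rwa [map_ratCast] at this

/-- The symmetric elements form a central copy of the real numbers, in which the elements `d* d` are
nonnegative. -/
theorem exists_real_ringHom : ∃ ρ : ℝ →+* D, (∀ r d, ρ r * d = d * ρ r) ∧
    (∀ r, star (ρ r) = ρ r) ∧ (∀ d, ∃ r, 0 ≤ r ∧ star d * d = ρ r) ∧
    ∀ a, star a = a → ∃ r, ρ r = a := by
  let h := ConditionallyCompleteLinearOrderedField.inducedOrderRingHom (symSubring D) ℝ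
  let e : symSubring D ≃+* ℝ := RingEquiv.ofBijective h ⟨h.toRingHom.injective,
    surjective_inducedMap⟩
  refine ⟨(symSubring D).subtype.comp e.symm.toRingHom,
    fun r d => (commute_of_star_eq (e.symm r).2 d).eq, fun r => (e.symm r).2, fun d => ?_,
    fun a ha => ⟨e ⟨a, ha⟩, congrArg Subtype.val (e.symm_apply_apply _)⟩⟩
  have hd := star_mul_self_nonneg' d
  refine ⟨e ⟨_, star_of_nonneg hd⟩, ?_,
    (congrArg Subtype.val (e.symm_apply_apply ⟨star d * d, star_of_nonneg hd⟩)).symm⟩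
  have : h 0 ≤ h ⟨_, star_of_nonneg hd⟩ := OrderHomClass.mono h hd
  rwa [map_zero] at this

end MonotoneCompleteDivisionRing

/-! ### Division algebras with involution over the reals -/

section Frobenius

variable {D : Type*} [DivisionRing D] [StarRing D] [Algebra ℝ D]

/-- A nonzero skew element has a negative square, so it can be scaled to an imaginary unit. -/
theorem exists_smul_mul_self_eq_neg_one
    (hpos : ∀ d : D, ∃ r : ℝ, 0 ≤ r ∧ star d * d = algebraMap ℝ D r) {x : D} (hx : star x = -x)
    (hx0 : x ≠ 0) : ∃ t : ℝ, t ≠ 0 ∧ (t • x) * (t • x) = -1 := by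
  obtain ⟨r, hr, hrx⟩ := hpos x
  have hr0 : r ≠ 0 := by
    rintro rfl
    rw [map_zero, hx, neg_mul, neg_eq_zero] at hrx
    exact hx0 (mul_self_eq_zero.mp hrx)
  have hrp : 0 < r := lt_of_le_of_ne hr hr0.symm
  refine ⟨(√r)⁻¹, inv_ne_zero (Real.sqrt_pos.mpr hrp).ne', ?_⟩
  have e : x * x = -(r • (1 : D)) := by
    rw [← Algebra.algebraMap_eq_smul_one, ← hrx, hx]
    noncomm_ring
  rw [smul_mul_smul_comm, e, smul_neg, smul_smul, ← mul_inv, Real.mul_self_sqrt hr,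
    inv_mul_cancel₀ hr0, one_smul]

/-- Frobenius' theorem for division rings with a positive involution whose symmetric elements are
the real numbers. -/
theorem nonempty_starRingEquiv_real_or_complex_or_quaternion
    (hstar : ∀ r : ℝ, star (algebraMap ℝ D r) = algebraMap ℝ D r)
    (hpos : ∀ d : D, ∃ r : ℝ, 0 ≤ r ∧ star d * d = algebraMap ℝ D r)
    (hsym : ∀ a : D, star a = a → ∃ r : ℝ, algebraMap ℝ D r = a) :
    Nonempty (D ≃⋆+* ℝ) ∨ Nonempty (D ≃⋆+* ℂ) ∨ Nonempty (D ≃⋆+* ℍ[ℝ]) := by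
  have hss : ∀ (r : ℝ) (d : D), star (r • d) = r • star d := fun r d => by
    rw [Algebra.smul_def, star_mul, hstar, ← Algebra.commutes, ← Algebra.smul_def]
  have h2 : (2 : D) ≠ 0 := by
    have := (map_ne_zero (algebraMap ℝ D)).mpr (two_ne_zero (α := ℝ))
    rwa [map_ofNat] at this
  -- Every element is the sum of a real number and a skew element.
  have hdec : ∀ d : D, ∃ (r : ℝ) (x : D), star x = -x ∧ d = algebraMap ℝ D r + x := fun d => by
    obtain ⟨r, hr⟩ := hsym (d + star d) (by rw [star_add, star_star, add_comm])
    refine ⟨r / 2, (1 / 2 : ℝ) • (d - star d), ?_, ?_⟩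
    · rw [hss, star_sub, star_star, ← smul_neg, neg_sub]
    · rw [div_eq_inv_mul, map_mul, hr, ← Algebra.smul_def]
      module
  by_cases hreal : ∀ x : D, star x = -x → x = 0
  · left
    have hb : Function.Bijective (algebraMap ℝ D) := by
      refine ⟨(algebraMap ℝ D).injective, fun d => ?_⟩
      obtain ⟨r, x, hx, rfl⟩ := hdec d
      exact ⟨r, by rw [hreal x hx, add_zero]⟩
    let e : ℝ ≃⋆+* D := ⟨RingEquiv.ofBijective (algebraMap ℝ D) hb, fun r => (hstar r).symm⟩
    exact ⟨e.symm⟩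
  push Not at hreal
  obtain ⟨i, hi, hii⟩ : ∃ i : D, star i = -i ∧ i * i = -1 := by
    obtain ⟨x, hx, hx0⟩ := hreal
    obtain ⟨t, -, ht⟩ := exists_smul_mul_self_eq_neg_one hpos hx hx0
    exact ⟨t • x, by rw [hss, hx, smul_neg], ht⟩
  right
  by_cases hcomplex : ∀ x : D, star x = -x → ∃ t : ℝ, x = t • i
  · left
    let f : ℂ →ₐ[ℝ] D := Complex.liftAux i hii
    have hf : ∀ z : ℂ, f z = algebraMap ℝ D z.re + z.im • i := Complex.liftAux_apply i hii
    have hb : Function.Bijective f := by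
      refine ⟨f.toRingHom.injective, fun d => ?_⟩
      obtain ⟨r, x, hx, rfl⟩ := hdec d
      obtain ⟨t, rfl⟩ := hcomplex x hx
      exact ⟨⟨r, t⟩, hf _⟩
    let e : ℂ ≃⋆+* D := ⟨RingEquiv.ofBijective f hb, fun z => by
      change f (star z) = star (f z)
      rw [hf, hf, star_add, hstar, hss, hi]
      simp⟩
    exact ⟨e.symm⟩
  right
  push Not at hcomplex
  have hcomm : ∀ {u x : D}, star u = -u → star x = -x →
      ∃ c : ℝ, u * x + x * u = c • (1 : D) := fun {u x} hu hx => by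
    obtain ⟨c, hc⟩ := hsym (u * x + x * u) (by
      rw [star_add, star_mul, star_mul, hu, hx, neg_mul_neg, neg_mul_neg, add_comm])
    exact ⟨c, by rw [← hc, Algebra.algebraMap_eq_smul_one]⟩
  obtain ⟨j, hj, hjj, hij⟩ : ∃ j : D, star j = -j ∧ j * j = -1 ∧ i * j + j * i = 0 := by
    -- Gram–Schmidt: `-(u x + x u) / 2` is the inner product of skew elements.
    obtain ⟨x, hx, hxi⟩ := hcomplex
    obtain ⟨c, hc⟩ := hcomm hi hx
    have hy : star (x + (c / 2) • i) = -(x + (c / 2) • i) := by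
      rw [star_add, hss, hx, hi, neg_add, smul_neg]
    have hy0 : x + (c / 2) • i ≠ 0 := fun h =>
      hxi (-(c / 2)) (by rw [neg_smul]; exact eq_neg_of_add_eq_zero_left h)
    obtain ⟨t, -, ht⟩ := exists_smul_mul_self_eq_neg_one hpos hy hy0
    refine ⟨t • (x + (c / 2) • i), by rw [hss, hy, smul_neg], ht, ?_⟩
    have e : i * (x + (c / 2) • i) + (x + (c / 2) • i) * i = 0 := by
      have e1 : i * (x + (c / 2) • i) + (x + (c / 2) • i) * i =
          (i * x + x * i) + c • (i * i) := by
        simp only [mul_add, add_mul, mul_smul_comm, smul_mul_assoc]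
        module
      rw [e1, hc, hii]
      module
    rw [mul_smul_comm, smul_mul_assoc, ← smul_add, e, smul_zero]
  have hji : j * i = -(i * j) := by rw [eq_neg_iff_add_eq_zero, add_comm, hij]
  let k := i * j
  have hk : star k = -k := by
    simp only [k]
    rw [star_mul, hi, hj, neg_mul_neg, hji]
  have hik : i * k = -j := by simp only [k]; rw [← mul_assoc, hii, neg_one_mul]
  have hki : k * i = j := by
    simp only [k]; rw [mul_assoc, hji, mul_neg, ← mul_assoc, hii, neg_one_mul, neg_neg]
  have hkj : k * j = -i := by simp only [k]; rw [mul_assoc, hjj, mul_neg_one]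
  have hjk : j * k = i := by
    simp only [k]; rw [← mul_assoc, hji, neg_mul, mul_assoc, hjj, mul_neg_one, neg_neg]
  have hkk : k * k = -1 := by
    have : k * k = i * (j * k) := mul_assoc i j k
    rw [this, hjk, hii]
  let B : QuaternionAlgebra.Basis D (-1 : ℝ) 0 (-1) :=
    { i := i
      j := j
      k := k
      i_mul_i := by rw [hii]; module
      j_mul_j := by rw [hjj]; module
      i_mul_j := rfl
      j_mul_i := by rw [hji, zero_smul, zero_sub] }
  let f : ℍ[ℝ] →ₐ[ℝ] D := B.liftHom
  have hf : ∀ q : ℍ[ℝ], f q = algebraMap ℝ D q.re + q.imI • i + q.imJ • j + q.imK • k :=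
    fun q => rfl
  have hb : Function.Bijective f := by
    refine ⟨f.toRingHom.injective, fun d => ?_⟩
    obtain ⟨r, x, hx, rfl⟩ := hdec d
    obtain ⟨a, ha⟩ := hcomm hi hx
    obtain ⟨b, hb⟩ := hcomm hj hx
    obtain ⟨c, hc⟩ := hcomm hk hx
    -- The part `y` of `x` orthogonal to `i`, `j` and `k` anticommutes with all three; but as
    -- `k = i j` it also commutes with `k`, so it is zero.
    generalize hy : x + (a / 2) • i + (b / 2) • j + (c / 2) • k = y
    have e1 : i * y + y * i = 0 := by
      have : i * y + y * i = (i * x + x * i) + a • (i * i) + (b / 2) • (i * j + j * i) +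
          (c / 2) • (i * k + k * i) := by
        rw [← hy]
        simp only [mul_add, add_mul, mul_smul_comm, smul_mul_assoc]
        module
      rw [this, ha, hii, hij, hik, hki]
      module
    have e2 : j * y + y * j = 0 := by
      have : j * y + y * j = (j * x + x * j) + b • (j * j) + (a / 2) • (i * j + j * i) +
          (c / 2) • (j * k + k * j) := by
        rw [← hy]
        simp only [mul_add, add_mul, mul_smul_comm, smul_mul_assoc]
        module
      rw [this, hb, hjj, hij, hjk, hkj]
      module
    have e3 : k * y + y * k = 0 := by
      have : k * y + y * k = (k * x + x * k) + c • (k * k) + (a / 2) • (i * k + k * i) +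
          (b / 2) • (j * k + k * j) := by
        rw [← hy]
        simp only [mul_add, add_mul, mul_smul_comm, smul_mul_assoc]
        module
      rw [this, hc, hkk, hik, hki, hjk, hkj]
      module
    have e4 : k * y = y * k := by
      have f1 : i * y = -(y * i) := eq_neg_of_add_eq_zero_left e1
      have f2 : j * y = -(y * j) := eq_neg_of_add_eq_zero_left e2
      simp only [k]
      rw [mul_assoc, f2, mul_neg, ← mul_assoc, f1, neg_mul, neg_neg, mul_assoc]
    have hk0 : k ≠ 0 := fun h => by simp [h] at hkk
    have hy0 : y = 0 := by
      rw [e4, ← mul_two, mul_assoc] at e3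
      exact (mul_eq_zero.mp e3).resolve_right (mul_ne_zero hk0 h2)
    refine ⟨⟨r, -(a / 2), -(b / 2), -(c / 2)⟩, ?_⟩
    refine (hf _).trans ?_
    have : x = y - ((a / 2) • i + (b / 2) • j + (c / 2) • k) := by rw [← hy]; abel
    rw [this, hy0]
    module
  let e : ℍ[ℝ] ≃⋆+* D := ⟨RingEquiv.ofBijective f hb, fun q => by
    change f (star q) = star (f q)
    rw [hf, hf, star_add, star_add, star_add, hstar, hss, hss, hss, hi, hj, hk]
    simp⟩
  exact ⟨e.symm⟩

end Frobenius

/-- A monotone complete division ring with involution is `ℝ`, `ℂ` or `ℍ`. -/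
theorem MonotoneCompleteDivisionRing.nonempty_starRingEquiv (D : Type*) [DivisionRing D]
    [StarRing D] [PartialOrder D] [MonotoneCompleteDivisionRing D] :
    Nonempty (D ≃⋆+* ℝ) ∨ Nonempty (D ≃⋆+* ℂ) ∨ Nonempty (D ≃⋆+* ℍ[ℝ]) := by
  obtain ⟨ρ, h1, h2, h3, h4⟩ := exists_real_ringHom (D := D)
  let : Algebra ℝ D := ρ.toAlgebra' h1
  exact nonempty_starRingEquiv_real_or_complex_or_quaternion h2 h3 h4

namespace HilbertCategory

variable {C : Type u} [Category.{v} C] [HilbertCategory C]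

/-! ### The scalars form a monotone complete division ring -/

/-- Nonzero scalars are invertible since `K` is simple. -/
noncomputable instance : DivisionRing (End (K : C)) where
  inv a := open Classical in if h : a = 0 then 0 else
    haveI := isIso_scalar (C := C) (a := a) h
    inv (show (K : C) ⟶ K from a)
  exists_pair_ne := ⟨𝟙 (K : C), 0, id_K_ne_zero⟩
  mul_inv_cancel a ha := by
    rw [dif_neg ha]
    have := isIso_scalar (C := C) (a := a) ha
    exact IsIso.inv_hom_id (show (K : C) ⟶ K from a)
  inv_zero := dif_pos rfl
  nnqsmul := _
  nnqsmul_def _ _ := rfl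
  qsmul := _
  qsmul_def _ _ := rfl

instance : StarRing (End (K : C)) where
  star a := dag (show (K : C) ⟶ K from a)
  star_involutive a := dag_dag (show (K : C) ⟶ K from a)
  star_mul a b := dag_comp (show (K : C) ⟶ K from b) (show (K : C) ⟶ K from a)
  star_add a b := dag_add (show (K : C) ⟶ K from a) (show (K : C) ⟶ K from b)

/-- `a ≤ b` when `b - a` is `x† ∘ x` for some vector `x`. -/
instance : PartialOrder (End (K : C)) where
  le a b := IsPos (C := C) (b - a)
  le_refl a := by
    rw [sub_self]
    exact isPos_zero
  le_trans a b c hab hbc := by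
    have := IsPos.add (C := C) hab hbc
    rwa [sub_add_sub_cancel'] at this
  le_antisymm a b hab hba := by
    have h := IsPos.eq_zero_of_add_eq_zero (C := C) hab hba
      ((sub_add_sub_cancel b a b).trans (sub_self b))
    exact (sub_eq_zero.mp h).symm

theorem scalar_le_iff {a b : End (K : C)} : a ≤ b ↔ IsPos (C := C) (b - a) := Iff.rfl

theorem scalar_nonneg_iff {a : End (K : C)} : 0 ≤ a ↔ IsPos (C := C) a := by
  rw [scalar_le_iff, sub_zero]

instance : MonotoneCompleteDivisionRing (End (K : C)) where
  add_le_add_left a b h c := by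
    rw [scalar_le_iff] at h ⊢
    rwa [add_sub_add_right_eq_sub]
  star_of_nonneg {a} ha := by
    obtain ⟨A, x, rfl⟩ := scalar_nonneg_iff.mp ha
    change dag (x ≫ dag x) = x ≫ dag x
    rw [dag_comp, dag_dag]
  conj_nonneg {a} d ha := by
    have := (scalar_nonneg_iff.mp ha).conj (show (K : C) ⟶ K from d)
    rw [← Category.assoc] at this
    rw [mul_assoc]
    exact scalar_nonneg_iff.mpr this
  zero_le_one := scalar_nonneg_iff.mpr ⟨K, 𝟙 K, by rw [dag_id, Category.comp_id]; rfl⟩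
  exists_isLUB a h0 hm hb := by
    obtain ⟨b, hb⟩ := hb
    obtain ⟨s, hs1, hs2⟩ := exists_isLUB_of_isPos (C := C) a (scalar_nonneg_iff.mp h0)
      (fun n => hm n.le_succ) b (fun n => hb ⟨n, rfl⟩)
    refine ⟨s, ?_, fun b' hb' => hs2 b' fun n => hb' ⟨n, rfl⟩⟩
    rintro _ ⟨n, rfl⟩
    exact hs1 n

/-! ### Orthonormal bases -/

/-- An orthonormal basis of the vectors of `A`: orthonormal vectors to which only zero is
orthogonal. -/
structure IsOrthonormalBasis {A : C} (S : Set (K ⟶ A)) : Prop where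
  norm : ∀ s ∈ S, s ≫ dag s = 𝟙 K
  orth : ∀ s ∈ S, ∀ t ∈ S, s ≠ t → s ≫ dag t = 0
  total : ∀ x : K ⟶ A, (∀ s ∈ S, x ≫ dag s = 0) → x = 0

/-- A maximal orthonormal set is a basis when every nonzero vector can be normalized. -/
theorem exists_isOrthonormalBasis
    (hN : ∀ {A : C} (x : K ⟶ A), x ≠ 0 → ∃ a : (K : C) ⟶ K, IsDaggerMono (a ≫ x)) (A : C) :
    ∃ S : Set (K ⟶ A), IsOrthonormalBasis S := by
  obtain ⟨S, hS⟩ := zorn_subset {S : Set (K ⟶ A) | (∀ s ∈ S, s ≫ dag s = 𝟙 K) ∧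
      ∀ s ∈ S, ∀ t ∈ S, s ≠ t → s ≫ dag t = 0} (by
    intro c hc hchain
    refine ⟨⋃₀ c, ⟨?_, ?_⟩, fun s hs => Set.subset_sUnion_of_mem hs⟩
    · rintro s ⟨T, hT, hs⟩
      exact (hc hT).1 s hs
    · rintro s ⟨T, hT, hs⟩ t ⟨U, hU, ht⟩ hst
      rcases hchain.total hT hU with h | h
      · exact (hc hU).2 s (h hs) t ht hst
      · exact (hc hT).2 s hs t (h ht) hst)
  refine ⟨S, hS.prop.1, hS.prop.2, fun x hx => ?_⟩
  by_contra hx0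
  obtain ⟨a, ha⟩ := hN x hx0
  have hax : ∀ s ∈ S, (a ≫ x) ≫ dag s = 0 := fun s hs => by
    rw [Category.assoc, hx s hs, comp_zero]
  have hax' : ∀ s ∈ S, s ≫ dag (a ≫ x) = 0 := fun s hs => by
    have := congrArg dag (hax s hs)
    rwa [dag_comp, dag_dag, dag_zero] at this
  have hmem : a ≫ x ∈ S := by
    refine hS.le_of_ge (y := insert (a ≫ x) S) ⟨?_, ?_⟩ (Set.subset_insert _ _)
      (Set.mem_insert _ _)
    · rintro s (rfl | hs)
      · exact ha
      · exact hS.prop.1 s hs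
    · rintro s (rfl | hs) t (rfl | ht) hst
      · exact absurd rfl hst
      · exact hax t ht
      · exact hax' s hs
      · exact hS.prop.2 s hs t ht hst
  exact id_K_ne_zero (ha.symm.trans (hax _ hmem))

namespace IsOrthonormalBasis

variable {A : C} {S : Set (K ⟶ A)} (hS : IsOrthonormalBasis S)
include hS

theorem hom_ext {B : C} {f g : A ⟶ B} (h : ∀ s ∈ S, s ≫ f = s ≫ g) : f = g := by
  rw [← sub_eq_zero, ← dag_dag (f - g)]
  have : dag (f - g) = 0 := by
    apply hom_ext_generator
    intro y
    rw [comp_zero]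
    apply hS.total
    intro s hs
    rw [Category.assoc, ← dag_comp, Preadditive.comp_sub, h s hs, sub_self, dag_zero, comp_zero]
  rw [this, dag_zero]

/-- The sum of the `t t†` for `t` in `I` is the projection on the span of `I`. -/
theorem comp_sum [DecidableEq S] (I : Finset S) (s : S) :
    s.1 ≫ ∑ t ∈ I, dag t.1 ≫ t.1 = if s ∈ I then s.1 else 0 := by
  rw [Preadditive.comp_sum, ← Finset.sum_ite_eq I s (fun t => t.1)]
  refine Finset.sum_congr rfl fun t _ => ?_
  split_ifs with h
  · rw [← h, ← Category.assoc, hS.norm _ s.2, Category.id_comp]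
  · rw [← Category.assoc, hS.orth _ s.2 _ t.2 (fun h' => h (Subtype.ext h')), zero_comp]

theorem sum_comp_sum {I J : Finset S} (h : I ⊆ J) (c : S → ((K : C) ⟶ K)) :
    (∑ s ∈ J, c s ≫ s.1) ≫ (∑ t ∈ I, dag t.1 ≫ t.1) = ∑ s ∈ I, c s ≫ s.1 := by
  classical
  rw [Preadditive.sum_comp]
  simp only [Category.assoc, hS.comp_sum]
  simp only [comp_ite, comp_zero]
  rw [← Finset.sum_filter, Finset.filter_mem_eq_inter, Finset.inter_eq_right.mpr h]

/-- The projection on the span of finitely many basis vectors splits. -/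
theorem exists_span (I : Finset S) : ∃ (M : C) (m : M ⟶ A), m ≫ dag m = 𝟙 M ∧
    dag m ≫ m = ∑ s ∈ I, dag s.1 ≫ s.1 := by
  classical
  generalize hp : ∑ s ∈ I, dag s.1 ≫ s.1 = p
  have hpd : dag p = p := by
    rw [← hp, dag_sum]
    simp only [dag_comp, dag_dag]
  have hpp : p ≫ p = p := by
    apply hS.hom_ext
    intro s hs
    rw [← hp, ← Category.assoc, hS.comp_sum I ⟨s, hs⟩]
    split_ifs with h
    · rw [hS.comp_sum I ⟨s, hs⟩, if_pos h]
    · rw [zero_comp]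
  obtain ⟨M, m, w, hm, ⟨hl⟩⟩ := exists_daggerEqualizer p (𝟙 A)
  have hm' : m ≫ dag m = 𝟙 M := hm
  obtain ⟨(l : A ⟶ M), (hl' : l ≫ m = p)⟩ :=
    Fork.IsLimit.lift' hl p (by rw [hpp, Category.comp_id])
  refine ⟨M, m, hm', ?_⟩
  have h1 : p ≫ dag m = dag m := by
    have := congrArg dag w
    rwa [dag_comp, dag_comp, dag_id, hpd, Category.id_comp] at this
  have h2 : p ≫ dag m = l := by rw [← hl', Category.assoc, hm', Category.comp_id]
  rw [← h1, h2, hl']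

/-- An object is the directed colimit of the spans of the finite subsets of an orthonormal
basis. -/
theorem exists_isDaggerColimit : ∃ (F : Finset S ⥤ C) (m : ∀ I, F.obj I ⟶ A),
    (∀ {I J} (h : I ⟶ J), IsDaggerMono (F.map h)) ∧
    (∀ {I J} (h : I ⟶ J), F.map h = m I ≫ dag (m J)) ∧ IsDaggerColimit F m ∧
    ∀ I, dag (m I) ≫ m I = ∑ s ∈ I, dag s.1 ≫ s.1 := by
  classical
  choose M m hm hp using hS.exists_span
  have hle : ∀ {I J : Finset S}, I ⊆ J → m I ≫ dag (m J) ≫ m J = m I := fun {I J} h => by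
    have h1 : (dag (m I) ≫ m I) ≫ (dag (m J) ≫ m J) = dag (m I) ≫ m I := by
      apply hS.hom_ext
      intro s hs
      rw [← Category.assoc, hp I, hp J, hS.comp_sum I ⟨s, hs⟩]
      split_ifs with hsI
      · rw [hS.comp_sum J ⟨s, hs⟩, if_pos (h hsI)]
      · rw [zero_comp]
    have h2 := congrArg (m I ≫ ·) h1
    simpa only [Category.assoc, reassoc_of% (hm I)] using h2
  let F : Finset S ⥤ C :=
    { obj := M
      map := fun {I J} _ => m I ≫ dag (m J)
      map_id := fun I => hm I
      map_comp := fun {I J L} f g => by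
        have := hle (leOfHom f)
        rw [Category.assoc, ← Category.assoc (dag (m J)), ← Category.assoc (m I), this] }
  have hFm : ∀ {I J : Finset S} (h : I ⟶ J), F.map h ≫ m J = m I := fun {I J} h => by
    change (m I ≫ dag (m J)) ≫ m J = m I
    rw [Category.assoc, hle (leOfHom h)]
  have hF : ∀ {I J : Finset S} (h : I ⟶ J), IsDaggerMono (F.map h) := fun {I J} h => by
    change (m I ≫ dag (m J)) ≫ dag (m I ≫ dag (m J)) = 𝟙 (M I)
    rw [dag_comp, dag_dag, ← Category.assoc, Category.assoc (m I), hle (leOfHom h), hm]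
  refine ⟨F, m, hF, fun h => rfl, isDaggerColimit_of_hom_ext F hF m hm hFm fun g hg => ?_, hp⟩
  apply hS.hom_ext
  intro s hs
  have h1 : s = (s ≫ dag (m {⟨s, hs⟩})) ≫ m {⟨s, hs⟩} := by
    rw [Category.assoc, hp, hS.comp_sum _ ⟨s, hs⟩, if_pos (Finset.mem_singleton_self _)]
  rw [h1, Category.assoc, hg, Category.comp_id]

/-- A morphism may be prescribed to send an orthonormal basis to orthonormal vectors. -/
theorem exists_hom {B : C} (g : S → (K ⟶ B)) (hg : ∀ s, g s ≫ dag (g s) = 𝟙 K)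
    (hg' : ∀ s t, s ≠ t → g s ≫ dag (g t) = 0) : ∃ f : A ⟶ B, ∀ s : S, s.1 ≫ f = g s := by
  classical
  obtain ⟨F, m, hF, hFm, hm, hp⟩ := hS.exists_isDaggerColimit
  have key : ∀ (I : Finset S) (s : S), s.1 ≫ ∑ t ∈ I, dag t.1 ≫ g t =
      if s ∈ I then g s else 0 := fun I s => by
    rw [Preadditive.comp_sum, ← Finset.sum_ite_eq I s]
    refine Finset.sum_congr rfl fun t _ => ?_
    split_ifs with h
    · rw [← h, ← Category.assoc, hS.norm _ s.2, Category.id_comp]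
    · rw [← Category.assoc, hS.orth _ s.2 _ t.2 (fun h' => h (Subtype.ext h')), zero_comp]
  have hmm : ∀ I, m I ≫ dag (m I) = 𝟙 _ := hm.mono
  obtain ⟨f, -, hf⟩ := hm.exists_desc (fun I => m I ≫ ∑ t ∈ I, dag t.1 ≫ g t)
    (fun I => by
      have h1 : (∑ t ∈ I, dag t.1 ≫ g t) ≫ dag (∑ t ∈ I, dag t.1 ≫ g t) =
          ∑ t ∈ I, dag t.1 ≫ t.1 := by
        apply hS.hom_ext
        intro s hs
        rw [← Category.assoc, key I ⟨s, hs⟩, hS.comp_sum I ⟨s, hs⟩, dag_sum]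
        split_ifs with h
        · rw [Preadditive.comp_sum, Finset.sum_eq_single_of_mem ⟨s, hs⟩ h]
          · rw [dag_comp, dag_dag, ← Category.assoc, hg, Category.id_comp]
          · intro t _ ht
            rw [dag_comp, dag_dag, ← Category.assoc, hg' _ _ ht.symm, zero_comp]
        · rw [zero_comp]
      rw [IsDaggerMono, dag_comp, Category.assoc, ← Category.assoc _ _ (dag (m I)), h1, ← hp,
        Category.assoc, hmm, Category.comp_id, hmm])
    (fun {I J} h => by
      have h1 : (dag (m I) ≫ m I) ≫ ∑ t ∈ J, dag t.1 ≫ g t = ∑ t ∈ I, dag t.1 ≫ g t := by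
        apply hS.hom_ext
        intro s hs
        rw [hp, ← Category.assoc, hS.comp_sum I ⟨s, hs⟩, key I ⟨s, hs⟩]
        split_ifs with hsI
        · rw [key J ⟨s, hs⟩, if_pos (leOfHom h hsI)]
        · rw [zero_comp]
      have h2 := congrArg (m I ≫ ·) h1
      simp only [Category.assoc, reassoc_of% (hmm I)] at h2
      rw [← Category.assoc, hm.comp, h2])
  refine ⟨f, fun s => ?_⟩
  have h1 : s.1 = (s.1 ≫ dag (m {s})) ≫ m {s} := by
    rw [Category.assoc, hp, hS.comp_sum, if_pos (Finset.mem_singleton_self _)]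
  have h2 : s.1 ≫ f = (s.1 ≫ (dag (m {s}) ≫ m {s})) ≫ f := by
    rw [← Category.assoc, ← h1]
  rw [h2, Category.assoc, Category.assoc, hf, ← Category.assoc (dag (m {s})), ← Category.assoc, hp,
    hS.comp_sum, if_pos (Finset.mem_singleton_self _), key,
    if_pos (Finset.mem_singleton_self _)]

/-- Bessel's inequality. -/
theorem isPos_sub_sum (x : K ⟶ A) (I : Finset S) :
    IsPos (x ≫ dag x - ∑ s ∈ I, (x ≫ dag s.1) ≫ dag (x ≫ dag s.1)) := by
  obtain ⟨M, m, hm, hp⟩ := hS.exists_span I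
  have h1 := isPos_sub_of_daggerMono hm x
  have h2 : (x ≫ dag m) ≫ dag (x ≫ dag m) = x ≫ (dag m ≫ m) ≫ dag x := by
    rw [dag_comp, dag_dag]
    simp only [Category.assoc]
  rw [h2, hp, Preadditive.sum_comp, Preadditive.comp_sum] at h1
  simpa only [dag_comp, dag_dag, Category.assoc] using h1

/-- The Riesz–Fischer theorem: there is a vector with any given coordinates of bounded norm. -/
theorem exists_vector (c : S → ((K : C) ⟶ K)) (b : (K : C) ⟶ K)
    (hb : ∀ I : Finset S, IsPos (b - ∑ s ∈ I, c s ≫ dag (c s))) :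
    ∃ x : K ⟶ A, (∀ s : S, x ≫ dag s.1 = c s) ∧ IsPos (b - x ≫ dag x) := by
  classical
  obtain ⟨F, m, hF, hFm, hm, hp⟩ := hS.exists_isDaggerColimit
  have hmm : ∀ I, m I ≫ dag (m I) = 𝟙 _ := hm.mono
  have hcoord : ∀ (I : Finset S) (s : S), s ∈ I → (∑ t ∈ I, c t ≫ t.1) ≫ dag s.1 = c s :=
    fun I s hs => by
      rw [Preadditive.sum_comp, Finset.sum_eq_single_of_mem s hs]
      · rw [Category.assoc, hS.norm _ s.2, Category.comp_id]
      · intro t _ hts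
        rw [Category.assoc, hS.orth _ t.2 _ s.2 (fun h' => hts (Subtype.ext h')), comp_zero]
  obtain ⟨x, hx1, hx2⟩ := hm.exists_vector hF (fun I => (∑ s ∈ I, c s ≫ s.1) ≫ dag (m I))
    (fun {I J} h => by
      have h1 : dag (m I) = (dag (m I) ≫ m I) ≫ dag (m I) := by
        rw [Category.assoc, hmm, Category.comp_id]
      rw [hFm, dag_comp, dag_dag, Category.assoc, ← Category.assoc (dag (m J)), ← Category.assoc,
        hp J, hS.sum_comp_sum (subset_refl J), h1, hp I, ← Category.assoc, ← Category.assoc,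
        hS.sum_comp_sum (leOfHom h), hS.sum_comp_sum (subset_refl I)]) b
    (fun I => by
      have : ((∑ s ∈ I, c s ≫ s.1) ≫ dag (m I)) ≫ dag ((∑ s ∈ I, c s ≫ s.1) ≫ dag (m I)) =
          ∑ s ∈ I, c s ≫ dag (c s) := by
        rw [dag_comp, dag_dag, Category.assoc, ← Category.assoc (dag (m I)), ← Category.assoc,
          hp I, hS.sum_comp_sum (subset_refl I), dag_sum, Preadditive.comp_sum]
        refine Finset.sum_congr rfl fun s hs => ?_
        rw [dag_comp, ← Category.assoc, hcoord I s hs]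
      rw [this]
      exact hb I)
  refine ⟨x, fun s => ?_, hx2⟩
  have h1 : dag s.1 = dag (m {s}) ≫ m {s} ≫ dag s.1 := by
    have h2 := hS.comp_sum {s} s
    rw [if_pos (Finset.mem_singleton_self _), ← hp] at h2
    have h3 := congrArg dag h2
    simp only [dag_comp, dag_dag, Category.assoc] at h3
    exact h3.symm
  rw [h1, ← Category.assoc, hx1, Category.assoc, ← Category.assoc (dag (m {s})), ← Category.assoc,
    hp, hS.sum_comp_sum (subset_refl _), hcoord _ _ (Finset.mem_singleton_self _)]

end IsOrthonormalBasis

end HilbertCategory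

/-! ### Right Hilbert spaces -/

namespace RightHilbertSpace

variable {𝕂 : Type*} [NormedDivisionRing 𝕂] [StarRing 𝕂] [NormedAlgebra ℝ 𝕂] [HilbertScalars 𝕂]
  {V : Type*} [NormedAddCommGroup V] [Module 𝕂ᵐᵒᵖ V] [RightHilbertSpace 𝕂 V]
  {W : Type*} [NormedAddCommGroup W] [Module 𝕂ᵐᵒᵖ W] [RightHilbertSpace 𝕂 W]

set_option linter.unusedSectionVars false in
theorem form_add_right (x y z : V) : form (𝕂 := 𝕂) x (y + z) = form x y + form x z := by
  rw [← star_form, form_add_left, star_add, star_form, star_form]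

set_option linter.unusedSectionVars false in
theorem form_smul_right (x y : V) (k : 𝕂) :
    form (𝕂 := 𝕂) x (MulOpposite.op k • y) = star k * form x y := by
  rw [← star_form, form_smul_left, star_mul, star_form]

/-- The Hellinger–Toeplitz theorem: a map with a formal adjoint is continuous, by the closed graph
theorem. -/
theorem continuous_of_form_eq (f : V → W) (g : W → V)
    (h : ∀ x y, form (𝕂 := 𝕂) (f x) y = form x (g y)) : Continuous f := by
  let := realInner 𝕂 V
  let := realInner 𝕂 W
  have : CompleteSpace V := complete 𝕂
  have : CompleteSpace W := complete 𝕂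
  have hext : ∀ {y z : W}, (∀ x, form (𝕂 := 𝕂) y x = form z x) → y = z := fun {y z} hyz =>
    ext_form 𝕂 fun x => by rw [← star_form, hyz, star_form]
  have hsmul : ∀ (k : 𝕂) (x : V), f (MulOpposite.op k • x) = MulOpposite.op k • f x :=
    fun k x => hext fun z => by rw [h, form_smul_left, form_smul_left, h]
  let f' : V →ₗ[ℝ] W :=
    { toFun := f
      map_add' := fun x y => hext fun z => by
        rw [h, form_add_left, form_add_left, h, h]
      map_smul' := fun r x => hsmul (algebraMap ℝ 𝕂 r) x }
  have hin : ∀ x y, inner ℝ (f' x) y = inner ℝ x (g y) := fun x y =>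
    congrArg scalarRe (h x y)
  apply f'.continuous_of_seq_closed_graph
  intro u x y hu hfu
  apply ext_inner_right ℝ
  intro z
  have h1 : Filter.Tendsto (fun n => inner ℝ (f' (u n)) z) Filter.atTop (nhds (inner ℝ y z)) :=
    hfu.inner tendsto_const_nhds
  have h2 : Filter.Tendsto (fun n => inner ℝ (u n) (g z)) Filter.atTop (nhds (inner ℝ x (g z))) :=
    hu.inner tendsto_const_nhds
  simp only [hin] at h1 ⊢
  exact tendsto_nhds_unique h1 h2

end RightHilbertSpace

namespace HilbertCategory

variable {C : Type u} [Category.{v} C] [HilbertCategory C]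

/-! ### Vectors as a right Hilbert space -/

section

variable {𝕂 : Type*} [NormedDivisionRing 𝕂] [StarRing 𝕂] (σ : End (K : C) ≃⋆+* 𝕂)

theorem scalar_comp (a b : (K : C) ⟶ K) : σ (b ≫ a) = σ a * σ b :=
  map_mul σ (show End (K : C) from a) (show End (K : C) from b)

theorem scalar_dag (a : (K : C) ⟶ K) : σ (dag a) = star (σ a) :=
  map_star σ (show End (K : C) from a)

theorem scalar_sub (a b : (K : C) ⟶ K) : σ (a - b) = σ a - σ b :=
  map_sub σ (show End (K : C) from a) (show End (K : C) from b)

variable [NormedAlgebra ℝ 𝕂] [HilbertScalars 𝕂]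

/-- Symmetric scalars are real, since `k + k*` is. -/
theorem exists_real_of_star_eq {k : 𝕂} (hk : star k = k) : ∃ r : ℝ, k = algebraMap ℝ 𝕂 r := by
  refine ⟨scalarRe k, ?_⟩
  have h := algebraMap_scalarRe k
  rw [hk, map_mul, ← two_mul, map_ofNat] at h
  have h2 : (2 : 𝕂) ≠ 0 := by
    have := (map_ne_zero (algebraMap ℝ 𝕂)).mpr (two_ne_zero (α := ℝ))
    rwa [map_ofNat] at this
  exact (mul_left_cancel₀ h2 h).symm

theorem scalar_comp_dag (a : (K : C) ⟶ K) : σ (a ≫ dag a) = algebraMap ℝ 𝕂 (‖σ a‖ ^ 2) := by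
  rw [scalar_comp, scalar_dag, HilbertScalars.star_mul_self]

theorem isPos_symm_algebraMap {r : ℝ} (hr : 0 ≤ r) :
    IsPos (C := C) (σ.symm (algebraMap ℝ 𝕂 r)) := by
  refine ⟨K, σ.symm (algebraMap ℝ 𝕂 √r), EquivLike.injective σ ?_⟩
  rw [scalar_comp_dag, StarRingEquiv.apply_symm_apply, StarRingEquiv.apply_symm_apply,
    norm_algebraMap', Real.norm_eq_abs, sq_abs, Real.sq_sqrt hr]

/-- Positive scalars correspond to nonnegative real numbers. A positive `a` is symmetric, hence
real; were it negative, then both `a` and `-a` would be positive, and `a = 0`. -/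
theorem IsPos.exists_real {a : (K : C) ⟶ K} (ha : IsPos a) :
    ∃ r : ℝ, 0 ≤ r ∧ σ a = algebraMap ℝ 𝕂 r := by
  have hs : star (σ a) = σ a := by
    obtain ⟨A, x, rfl⟩ := ha
    rw [← scalar_dag, dag_comp, dag_dag]
  obtain ⟨r, hr⟩ := exists_real_of_star_eq hs
  rcases le_total 0 r with h | h
  · exact ⟨r, h, hr⟩
  · refine ⟨0, le_rfl, ?_⟩
    have h1 := isPos_symm_algebraMap σ (neg_nonneg.mpr h)
    have h2 : a + (show (K : C) ⟶ K from σ.symm (algebraMap ℝ 𝕂 (-r))) = 0 := by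
      apply EquivLike.injective σ
      refine (map_add σ (show End (K : C) from a) (σ.symm (algebraMap ℝ 𝕂 (-r)))).trans ?_
      rw [StarRingEquiv.apply_symm_apply]
      exact (congrArg₂ (· + ·) hr (map_neg (algebraMap ℝ 𝕂) r)).trans
        ((add_neg_cancel _).trans (map_zero σ).symm)
    rw [ha.eq_zero_of_add_eq_zero h1 h2, map_zero, map_zero]

include σ in
/-- Every nonzero vector can be normalized, since its norm is a positive real number. -/
theorem exists_isDaggerMono_comp {A : C} (x : K ⟶ A) (hx : x ≠ 0) :
    ∃ a : (K : C) ⟶ K, IsDaggerMono (a ≫ x) := by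
  obtain ⟨r, hr, hxr⟩ := (isPos_self x).exists_real σ
  have hr0 : r ≠ 0 := by
    rintro rfl
    rw [map_zero] at hxr
    exact hx (eq_zero_of_comp_dag_eq_zero (EquivLike.injective σ (hxr.trans (map_zero σ).symm)))
  refine ⟨σ.symm (algebraMap ℝ 𝕂 (√r)⁻¹), EquivLike.injective σ ?_⟩
  rw [dag_comp, Category.assoc, ← Category.assoc x, scalar_comp, scalar_comp, scalar_dag, hxr,
    StarRingEquiv.apply_symm_apply, star_algebraMap_real, ← map_mul, ← map_mul, mul_right_comm,
    ← mul_inv, Real.mul_self_sqrt hr, inv_mul_cancel₀ hr0, map_one]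
  exact (map_one σ).symm

variable (A : C)

/-- Scalars act on vectors by precomposition. -/
noncomputable abbrev homModule : Module 𝕂ᵐᵒᵖ (K ⟶ A) where
  smul k x := (show (K : C) ⟶ K from σ.symm k.unop) ≫ x
  one_smul x := by
    change (show (K : C) ⟶ K from σ.symm 1) ≫ x = x
    rw [map_one]
    exact Category.id_comp x
  mul_smul k l x := by
    change (show (K : C) ⟶ K from σ.symm (l.unop * k.unop)) ≫ x =
      (show (K : C) ⟶ K from σ.symm k.unop) ≫ (show (K : C) ⟶ K from σ.symm l.unop) ≫ x
    rw [map_mul, ← Category.assoc]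
    rfl
  smul_zero k := comp_zero
  smul_add k x y := Preadditive.comp_add _ _ _ _ _ _
  add_smul k l x := by
    change (show (K : C) ⟶ K from σ.symm (k.unop + l.unop)) ≫ x = _
    rw [map_add]
    exact Preadditive.add_comp _ _ _ _ _ _
  zero_smul x := by
    change (show (K : C) ⟶ K from σ.symm 0) ≫ x = 0
    rw [map_zero]
    exact zero_comp

/-- The real inner product on vectors. -/
noncomputable abbrev homCore : letI := homModule σ A
    letI : Module ℝ (K ⟶ A) := Module.compHom _ (algebraMap ℝ 𝕂ᵐᵒᵖ)
    InnerProductSpace.Core ℝ (K ⟶ A) :=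
  letI := homModule σ A
  letI : Module ℝ (K ⟶ A) := Module.compHom _ (algebraMap ℝ 𝕂ᵐᵒᵖ)
  { inner := fun x y => scalarRe (σ (x ≫ dag y))
    conj_inner_symm := fun x y => by
      rw [conj_trivial, ← scalarRe_star, ← scalar_dag, dag_comp, dag_dag]
    re_inner_nonneg := fun x => by
      obtain ⟨r, hr, hx⟩ := (isPos_self x).exists_real σ
      simpa only [hx, scalarRe_algebraMap, RCLike.re_to_real] using hr
    add_left := fun x y z => by
      rw [Preadditive.add_comp, ← scalarRe_add]
      exact congrArg scalarRe (map_add σ _ _)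
    smul_left := fun x y r => by
      change scalarRe (σ (((show (K : C) ⟶ K from σ.symm (algebraMap ℝ 𝕂 r)) ≫ x) ≫ dag y)) = _
      rw [Category.assoc, scalar_comp, StarRingEquiv.apply_symm_apply, scalarRe_mul_real]
      rfl
    definite := fun x hx => by
      obtain ⟨r, hr, hxr⟩ := (isPos_self x).exists_real σ
      rw [hxr, scalarRe_algebraMap] at hx
      rw [hx, map_zero] at hxr
      exact eq_zero_of_comp_dag_eq_zero (EquivLike.injective σ (hxr.trans (map_zero σ).symm)) }

/-- The norm on vectors, with `‖x‖² = x† ∘ x`. -/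
noncomputable abbrev homNormedAddCommGroup : NormedAddCommGroup (K ⟶ A) :=
  letI := homModule σ A
  letI : Module ℝ (K ⟶ A) := Module.compHom _ (algebraMap ℝ 𝕂ᵐᵒᵖ)
  (homCore σ A).toNormedAddCommGroup

theorem scalar_self {A : C} (x : K ⟶ A) : letI := homNormedAddCommGroup σ A
    σ (x ≫ dag x) = algebraMap ℝ 𝕂 (‖x‖ ^ 2) := by
  obtain ⟨r, hr, hx⟩ := (isPos_self x).exists_real σ
  have h : (homNormedAddCommGroup σ A).toNorm.norm x = √(scalarRe (σ (x ≫ dag x))) := rfl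
  rw [h, hx, scalarRe_algebraMap, Real.sq_sqrt hr]

theorem isPos_iff_of_eq {a : (K : C) ⟶ K} {r : ℝ} (h : σ a = algebraMap ℝ 𝕂 r) :
    IsPos a ↔ 0 ≤ r := by
  constructor
  · intro ha
    obtain ⟨t, ht, hat⟩ := ha.exists_real σ
    rwa [(algebraMap ℝ 𝕂).injective (h.symm.trans hat)]
  · intro hr
    have := isPos_symm_algebraMap σ hr
    rwa [← h, StarRingEquiv.symm_apply_apply] at this

theorem scalar_sum {ι : Type*} (I : Finset ι) (c : ι → ((K : C) ⟶ K)) :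
    σ (∑ s ∈ I, c s ≫ dag (c s)) = algebraMap ℝ 𝕂 (∑ s ∈ I, ‖σ (c s)‖ ^ 2) := by
  rw [map_sum, map_sum]
  exact Finset.sum_congr rfl fun s _ => scalar_comp_dag σ (c s)

/-- Parseval's identity. If `b` bounds the partial sums, then a vector with the coordinates of `x`
and norm at most `b` exists by the Riesz–Fischer theorem, and it is `x`. -/
theorem IsOrthonormalBasis.hasSum {A : C} {S : Set (K ⟶ A)} (hS : IsOrthonormalBasis S)
    (x : K ⟶ A) : letI := homNormedAddCommGroup σ A
    HasSum (fun s : S => ‖σ (x ≫ dag s.1)‖ ^ 2) (‖x‖ ^ 2) := by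
  let := homNormedAddCommGroup σ A
  apply hasSum_of_isLUB_of_nonneg _ (fun s => by positivity)
  refine ⟨?_, fun b hb => ?_⟩
  · rintro _ ⟨I, rfl⟩
    have h := hS.isPos_sub_sum x I
    rw [isPos_iff_of_eq σ (r := ‖x‖ ^ 2 - ∑ s ∈ I, ‖σ (x ≫ dag s.1)‖ ^ 2)
      (by rw [scalar_sub, scalar_sum, scalar_self, map_sub])] at h
    exact sub_nonneg.mp h
  · obtain ⟨y, hy, hyb⟩ := hS.exists_vector (fun s => x ≫ dag s.1) (σ.symm (algebraMap ℝ 𝕂 b))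
      (fun I => by
        rw [isPos_iff_of_eq σ (r := b - ∑ s ∈ I, ‖σ (x ≫ dag s.1)‖ ^ 2)
          (by rw [scalar_sub, scalar_sum, StarRingEquiv.apply_symm_apply, map_sub])]
        exact sub_nonneg.mpr (hb ⟨I, rfl⟩))
    have hyx : y = x := by
      rw [← sub_eq_zero]
      apply hS.total
      intro s hs
      rw [Preadditive.sub_comp, hy ⟨s, hs⟩, sub_self]
    rw [hyx, isPos_iff_of_eq σ (r := b - ‖x‖ ^ 2)
      (by rw [scalar_sub, StarRingEquiv.apply_symm_apply, scalar_self, map_sub])] at hyb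
    exact sub_nonneg.mp hyb

/-- Coordinates in an orthonormal basis identify the vectors of `A` with an `ℓ²` space. -/
theorem completeSpace_hom [CompleteSpace 𝕂] : letI := homNormedAddCommGroup σ A
    CompleteSpace (K ⟶ A) := by
  let := homNormedAddCommGroup σ A
  obtain ⟨S, hS⟩ := exists_isOrthonormalBasis (fun x hx => exists_isDaggerMono_comp σ x hx) A
  have h2 : (2 : ENNReal).toReal = (2 : ℕ) := by simp
  have hmem : ∀ x : K ⟶ A, Memℓp (fun s : S => σ (x ≫ dag s.1)) 2 := fun x => by
    rw [memℓp_gen_iff (by simp)]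
    simp only [h2, Real.rpow_natCast]
    exact (hS.hasSum σ x).summable
  let Φ : (K ⟶ A) →+ lp (fun _ : S => 𝕂) 2 :=
    { toFun := fun x => ⟨_, hmem x⟩
      map_zero' := by
        ext s
        change σ (0 ≫ dag s.1) = 0
        rw [zero_comp]
        exact map_zero σ
      map_add' := fun x y => by
        ext s
        change σ ((x + y) ≫ dag s.1) = σ (x ≫ dag s.1) + σ (y ≫ dag s.1)
        rw [Preadditive.add_comp]
        exact map_add σ _ _ }
  have hΦ : ∀ (x : K ⟶ A) (s : S), Φ x s = σ (x ≫ dag s.1) := fun x s => rfl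
  have hiso : Isometry Φ := by
    apply AddMonoidHomClass.isometry_of_norm
    intro x
    have h3 := lp.norm_rpow_eq_tsum (p := 2) (by simp) (Φ x)
    simp only [h2, Real.rpow_natCast, hΦ] at h3
    rw [(hS.hasSum σ x).tsum_eq] at h3
    exact (sq_eq_sq₀ (norm_nonneg _) (norm_nonneg _)).mp h3
  have hsurj : Function.Surjective Φ := by
    intro f
    obtain ⟨x, hx, -⟩ := hS.exists_vector (fun s => σ.symm (f s))
      (σ.symm (algebraMap ℝ 𝕂 (‖f‖ ^ 2)))
      (fun I => by
        rw [isPos_iff_of_eq σ (r := ‖f‖ ^ 2 - ∑ s ∈ I, ‖f s‖ ^ 2) (by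
          rw [scalar_sub, scalar_sum, StarRingEquiv.apply_symm_apply, map_sub]
          simp only [StarRingEquiv.apply_symm_apply])]
        have h3 := lp.sum_rpow_le_norm_rpow (p := 2) (by simp) f I
        simp only [h2, Real.rpow_natCast] at h3
        exact sub_nonneg.mpr h3)
    refine ⟨x, ?_⟩
    ext s
    rw [hΦ, hx, StarRingEquiv.apply_symm_apply]
  exact (hiso.isUniformInducing.completeSpace_congr hsurj).mpr inferInstance

/-- The right Hilbert space of vectors of `A`. -/
noncomputable abbrev homHilbert [CompleteSpace 𝕂] : letI := homNormedAddCommGroup σ A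
    letI := homModule σ A
    RightHilbertSpace 𝕂 (K ⟶ A) :=
  letI := homNormedAddCommGroup σ A
  letI := homModule σ A
  { form := fun x y => σ (x ≫ dag y)
    form_add_left := fun x y z => by
      have : (x + y) ≫ dag z = x ≫ dag z + y ≫ dag z := Preadditive.add_comp _ _ _ _ _ _
      rw [this]
      exact map_add σ _ _
    form_smul_left := fun x y k => by
      change σ (((show (K : C) ⟶ K from σ.symm k) ≫ x) ≫ dag y) = _
      rw [Category.assoc, scalar_comp, StarRingEquiv.apply_symm_apply]
    star_form := fun x y => by rw [← scalar_dag, dag_comp, dag_dag]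
    form_self := fun x => scalar_self σ x
    complete := completeSpace_hom σ A }

/-- An identification of the scalars with `𝕂` lifts `C(K, -)` to right Hilbert spaces. -/
noncomputable def homLift [CompleteSpace 𝕂] : HomLift C 𝕂 where
  scalar := σ.toEquiv
  scalar_add a b := map_add σ (show End (K : C) from a) (show End (K : C) from b)
  scalar_comp a b := scalar_comp σ a b
  scalar_dag a := scalar_dag σ a
  group A := homNormedAddCommGroup σ A
  module A := homModule σ A
  hilbert A := homHilbert σ A
  add_eq x y := rfl
  smul_eq x a := by
    change (show (K : C) ⟶ K from σ.symm (σ a)) ≫ x = a ≫ x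
    rw [StarRingEquiv.symm_apply_apply]
  form_eq x y := rfl
  continuous_comp {A B} f := by
    let := homNormedAddCommGroup σ A
    let := homModule σ A
    let := homHilbert σ A
    let := homNormedAddCommGroup σ B
    let := homModule σ B
    let := homHilbert σ B
    refine RightHilbertSpace.continuous_of_form_eq (𝕂 := 𝕂) (fun x : K ⟶ A => x ≫ f)
      (fun y : K ⟶ B => y ≫ dag f) fun x y => ?_
    change σ ((x ≫ f) ≫ dag y) = σ (x ≫ dag (y ≫ dag f))
    rw [dag_comp, dag_dag, Category.assoc]

end

end HilbertCategory

/-! ### Dilation of bounded operators -/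

namespace RightHilbertSpace

variable {𝕂 : Type*} [NormedDivisionRing 𝕂] [StarRing 𝕂] [NormedAlgebra ℝ 𝕂] [HilbertScalars 𝕂]
  {V : Type*} [NormedAddCommGroup V] [Module 𝕂ᵐᵒᵖ V] [RightHilbertSpace 𝕂 V]
  {W : Type*} [NormedAddCommGroup W] [Module 𝕂ᵐᵒᵖ W] [RightHilbertSpace 𝕂 W]

theorem norm_op_smul (k : 𝕂) (x : V) : ‖MulOpposite.op k • x‖ = ‖k‖ * ‖x‖ := by
  have h := form_self (𝕂 := 𝕂) (MulOpposite.op k • x)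
  rw [form_smul_left, form_smul_right, form_self, mul_assoc, Algebra.commutes, ← mul_assoc,
    HilbertScalars.star_mul_self, ← map_mul, (algebraMap ℝ 𝕂).injective.eq_iff] at h
  rw [← sq_eq_sq₀ (by positivity) (by positivity), ← h, mul_pow]

/-- In a complete normed algebra over the reals, a small element `t` of a closed subset which is
stable under `y ↦ (t + y²) / 2` has a solution `y = (t + y²) / 2` there, so that `1 - y` is a square
root of `1 - t`. -/
theorem exists_mul_self_one_sub {E : Type*} [NormedRing E] [NormedAlgebra ℝ E] [CompleteSpace E]
    {t : E} (ht : ‖t‖ ≤ 1 / 4) {s : Set E} (hs : IsClosed s) (h0 : 0 ∈ s)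
    (hst : ∀ y ∈ s, (1 / 2 : ℝ) • (t + y * y) ∈ s) : ∃ y ∈ s, (1 - y) * (1 - y) = 1 - t := by
  let f : E → E := fun y => (1 / 2 : ℝ) • (t + y * y)
  let B : Set E := s ∩ Metric.closedBall 0 (1 / 4)
  have hB : IsComplete B := (hs.inter Metric.isClosed_closedBall).isComplete
  have hmap : Set.MapsTo f B B := fun y hy => by
    refine ⟨hst y hy.1, ?_⟩
    have hy2 : ‖y‖ ≤ 1 / 4 := by simpa using hy.2
    rw [mem_closedBall_zero_iff]
    have h1 : ‖y * y‖ ≤ 1 / 4 * (1 / 4) := (norm_mul_le y y).trans (by gcongr)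
    calc ‖f y‖ = 1 / 2 * ‖t + y * y‖ := by rw [norm_smul]; norm_num
      _ ≤ 1 / 2 * (‖t‖ + ‖y * y‖) := by gcongr; exact norm_add_le _ _
      _ ≤ 1 / 4 := by linarith
  have hc : ContractingWith (1 / 2) (hmap.restrict f B B) := by
    refine ⟨by norm_num, LipschitzWith.of_dist_le_mul fun y z => ?_⟩
    have hy2 : ‖y.1‖ ≤ 1 / 4 := by simpa using y.2.2
    have hz2 : ‖z.1‖ ≤ 1 / 4 := by simpa using z.2.2
    rw [Subtype.dist_eq, Subtype.dist_eq, dist_eq_norm, dist_eq_norm]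
    have e : f y.1 - f z.1 = (1 / 2 : ℝ) • (y.1 * (y.1 - z.1) + (y.1 - z.1) * z.1) := by
      simp only [f, ← smul_sub]
      congr 1
      noncomm_ring
    have h1 : ‖y.1 * (y.1 - z.1)‖ ≤ 1 / 4 * ‖y.1 - z.1‖ :=
      (norm_mul_le _ _).trans (by gcongr)
    have h2 : ‖(y.1 - z.1) * z.1‖ ≤ ‖y.1 - z.1‖ * (1 / 4) :=
      (norm_mul_le _ _).trans (by gcongr)
    calc ‖f y.1 - f z.1‖ = 1 / 2 * ‖y.1 * (y.1 - z.1) + (y.1 - z.1) * z.1‖ := by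
          rw [e, norm_smul]; norm_num
      _ ≤ 1 / 2 * (‖y.1 * (y.1 - z.1)‖ + ‖(y.1 - z.1) * z.1‖) := by
          gcongr; exact norm_add_le _ _
      _ ≤ ((1 / 2 : NNReal) : ℝ) * ‖y.1 - z.1‖ := by
          push_cast
          have := norm_nonneg (y.1 - z.1)
          linarith
  obtain ⟨y, hy, hfy, -⟩ := hc.exists_fixedPoint' hB hmap (x := 0)
    ⟨h0, by simp⟩ (edist_ne_top _ _)
  refine ⟨y, hy.1, ?_⟩
  have hfy' : (1 / 2 : ℝ) • (t + y * y) = y := hfy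
  have h2 : t + y * y = y + y := by
    have := congrArg ((2 : ℝ) • ·) hfy'
    simp only [smul_smul] at this
    norm_num at this
    rw [this, two_smul]
  have h3 : (1 - y) * (1 - y) = 1 - (y + y) + y * y := by noncomm_ring
  rw [h3, ← h2]
  abel

/-- A bounded operator is a multiple of an operator `T'` for which `1 - T'* T'` is the square of a
symmetric operator `R`. So `x ↦ (T' x, R x)` is isometric. -/
theorem exists_dilation (T : V →L[𝕂ᵐᵒᵖ] W) : ∃ (n : ℕ) (T' : V → W) (T'' : W → V) (R : V → V),
    (∀ x, T x = n • T' x) ∧ (∀ x y, form (𝕂 := 𝕂) (T' x) y = form x (T'' y)) ∧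
    (∀ x y, form (𝕂 := 𝕂) (R x) y = form x (R y)) ∧ ∀ x, R (R x) + T'' (T' x) = x := by
  let := realInner 𝕂 V
  let := realInner 𝕂 W
  have : CompleteSpace V := complete 𝕂
  have hcoe : ∀ (r : ℝ) (x : V), r • x = MulOpposite.op (algebraMap ℝ 𝕂 r) • x := fun _ _ => rfl
  have hcoeW : ∀ (r : ℝ) (x : W), r • x = MulOpposite.op (algebraMap ℝ 𝕂 r) • x := fun _ _ => rfl
  let P : V →L[ℝ] V :=
    { toFun := fun x => adjoint T (T x)
      map_add' := fun x y => by rw [map_add, map_add]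
      map_smul' := fun r x => by
        rw [RingHom.id_apply, hcoe, map_smul, map_smul, hcoe]
      cont := (adjoint T).cont.comp T.cont }
  -- With `T' = n⁻¹ T` and `n` this large, `t = T'* T'` has norm at most `1 / 4`.
  obtain ⟨n, hn⟩ := exists_nat_gt (max 1 (4 * ‖P‖))
  have hn1 : (1 : ℝ) < n := (le_max_left _ _).trans_lt hn
  have hnP : 4 * ‖P‖ < n := (le_max_right _ _).trans_lt hn
  have hn0 : (n : ℝ) ≠ 0 := by positivity
  let c : ℝ := (n : ℝ)⁻¹
  let t : V →L[ℝ] V := (c * c) • P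
  have ht : ‖t‖ ≤ 1 / 4 := by
    have h1 : ‖t‖ = c * c * ‖P‖ := by
      rw [norm_smul, Real.norm_of_nonneg (by positivity)]
    have hc1 : c ≤ 1 := inv_le_one_of_one_le₀ hn1.le
    have hc2 : c * ‖P‖ ≤ 1 / 4 := by
      rw [← div_eq_inv_mul, div_le_iff₀ (by linarith)]
      linarith
    have hc0 : 0 ≤ c * ‖P‖ := by positivity
    rw [h1, mul_assoc]
    nlinarith
  let M : 𝕂 → V →L[ℝ] V := fun k => LinearMap.mkContinuous
    { toFun := fun x => MulOpposite.op k • x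
      map_add' := smul_add _
      map_smul' := fun r x => by
        rw [RingHom.id_apply, hcoe, hcoe, smul_smul, smul_smul, ← MulOpposite.op_mul,
          ← MulOpposite.op_mul, Algebra.commutes] } ‖k‖ (fun x => (norm_op_smul k x).le)
  have hM : ∀ k x, M k x = MulOpposite.op k • x := fun _ _ => rfl
  -- The square root of `1 - t` is sought among the real-linear operators which commute with the
  -- scalars and are symmetric for the real inner product. Stated so, the condition is plainly
  -- closed; it says that the operator is symmetric for the form.
  let s : Set (V →L[ℝ] V) := {y | (∀ k, y * M k = M k * y) ∧
    ∀ x z, inner ℝ (y x) z = inner ℝ x (y z)}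
  have hform : ∀ y : V →L[ℝ] V, y ∈ s ↔ ∀ x z, form (𝕂 := 𝕂) (y x) z = form x (y z) := by
    intro y
    constructor
    · rintro ⟨h1, h2⟩ x z
      apply eq_of_scalarRe_mul
      intro k
      rw [← form_smul_left, ← form_smul_left]
      have h3 : MulOpposite.op k • y x = y (MulOpposite.op k • x) :=
        (congrArg (fun f => f x) (h1 k)).symm
      rw [h3]
      exact h2 _ _
    · intro h
      refine ⟨fun k => ?_, fun x z => congrArg scalarRe (h x z)⟩
      ext x
      apply ext_form 𝕂
      intro z
      change form z (y (MulOpposite.op k • x)) = form z (MulOpposite.op k • y x)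
      rw [← h, form_smul_right, form_smul_right, h]
  have hs : IsClosed s := by
    have : s = (⋂ k, {y | y * M k = M k * y}) ∩
        ⋂ x, ⋂ z, {y | inner ℝ (y x) z = inner ℝ x (y z)} := by
      ext y
      simp [s]
    rw [this]
    refine IsClosed.inter (isClosed_iInter fun k => isClosed_eq (by fun_prop) (by fun_prop))
      (isClosed_iInter fun x => isClosed_iInter fun z => isClosed_eq (by fun_prop) (by fun_prop))
  have hcr : ∀ (r : ℝ) (x z : V), form (𝕂 := 𝕂) (r • x) z = form x (r • z) := fun r x z => by
    rw [hcoe, hcoe, form_smul_left, form_smul_right, star_algebraMap_real, Algebra.commutes]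
  have hP : ∀ x z : V, form (𝕂 := 𝕂) (P x) z = form x (P z) := fun x z => by
    change form (adjoint T (T x)) z = form x (adjoint T (T z))
    rw [← form_adjoint, ← star_form z, ← form_adjoint, star_form]
  obtain ⟨y, hy, hyt⟩ := exists_mul_self_one_sub ht hs
    ((hform 0).mpr fun x z => by
      have h1 := hcr 0 x z
      rwa [zero_smul, zero_smul] at h1)
    (fun y hy => (hform _).mpr fun x z => by
      have hy' := (hform y).mp hy
      change form ((1 / 2 : ℝ) • ((c * c) • P x + y (y x))) z =
        form x ((1 / 2 : ℝ) • ((c * c) • P z + y (y z)))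
      rw [hcr, form_add_left, hcr, hP, hy', hy', ← form_add_right]
      simp only [map_smul, smul_add, smul_smul]
      rw [mul_comm (c * c)])
  refine ⟨n, fun x => c • T x, fun z => c • adjoint T z, fun x => x - y x, fun x => ?_,
    fun x z => ?_, fun x z => ?_, fun x => ?_⟩
  · rw [← Nat.cast_smul_eq_nsmul ℝ, smul_smul, mul_inv_cancel₀ hn0, one_smul]
  · change form (c • T x) z = form x (c • adjoint T z)
    rw [hcoeW, hcoe, form_smul_left, form_smul_right, star_algebraMap_real, Algebra.commutes,
      form_adjoint]
  · have e := (hform y).mp hy x z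
    have e1 := form_add_left (𝕂 := 𝕂) (x - y x) (y x) z
    have e2 := form_add_right (𝕂 := 𝕂) x (z - y z) (y z)
    rw [sub_add_cancel] at e1 e2
    rw [e1, e] at e2
    exact add_right_cancel e2
  · have h1 : (x - y x) - y (x - y x) = x - (c * c) • P x := congrArg (fun f => f x) hyt
    have h2 : c • adjoint T (c • T x) = (c * c) • P x := by
      rw [hcoeW, map_smul, ← hcoe, smul_smul]
      rfl
    change (x - y x) - y (x - y x) + c • adjoint T (c • T x) = x
    rw [h1, h2, sub_add_cancel]

end RightHilbertSpace

namespace HilbertCategory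

variable {C : Type u} [Category.{v} C] [HilbertCategory C] {𝕂 : Type*}
  [NormedDivisionRing 𝕂] [StarRing 𝕂] [NormedAlgebra ℝ 𝕂]

/-! ### The lifted functor is a full dagger functor -/

/-- The identification of the scalars contained in a lift. -/
def starRingEquivOfHomLift (L : HomLift C 𝕂) : End (K : C) ≃⋆+* 𝕂 where
  toEquiv := L.scalar
  map_mul' a b := L.scalar_comp a b
  map_add' a b := L.scalar_add a b
  map_star' a := L.scalar_dag a

/-- Multiples in the group structure contained in a lift are multiples of morphisms. -/
theorem nsmul_carrier_eq (L : HomLift C 𝕂) {A : C} (n : ℕ) (x : (L.functor.obj A).carrier) :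
    n • x = (n • (show K ⟶ A from x) : K ⟶ A) := by
  have hadd : ∀ x y : (L.functor.obj A).carrier,
      x + y = ((show K ⟶ A from x) + (show K ⟶ A from y) : K ⟶ A) := fun x y => L.add_eq x y
  induction n with
  | zero =>
    rw [zero_nsmul, zero_nsmul]
    have h := hadd (0 : K ⟶ A) (0 : K ⟶ A)
    exact (add_eq_left.mp (h.trans (add_zero (0 : K ⟶ A)))).symm
  | succ n ih =>
    rw [succ_nsmul, succ_nsmul, ih]
    exact hadd _ _

variable [HilbertScalars 𝕂]

theorem isDaggerFunctor_functor (L : HomLift C 𝕂) : IsDaggerFunctor L.functor := by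
  intro A B f
  refine RightHilbertSpace.eq_adjoint (𝕂 := 𝕂) (V := (L.functor.obj A).carrier)
    (W := (L.functor.obj B).carrier) (L.functor.map f) (L.functor.map (dag f)) fun x y => ?_
  have e : ∀ (x : K ⟶ A) (y : K ⟶ B),
      L.scalar ((x ≫ f) ≫ dag y) = L.scalar (x ≫ dag (y ≫ dag f)) := fun x y => by
    rw [dag_comp, dag_dag, Category.assoc]
  exact (L.form_eq (A := B) _ y).trans ((e x y).trans (L.form_eq (A := A) x _).symm)

/-- The dilation of a bounded operator, in terms of the daggers of vectors. -/
theorem exists_dilation_hom (L : HomLift C 𝕂) {A B : C}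
    (T : (L.functor.obj A).carrier →L[𝕂ᵐᵒᵖ] (L.functor.obj B).carrier) :
    ∃ (n : ℕ) (T' : (K ⟶ A) → (K ⟶ B)) (T'' : (K ⟶ B) → (K ⟶ A)) (R : (K ⟶ A) → (K ⟶ A)),
      (∀ x : K ⟶ A, T x = n • T' x) ∧ (∀ x y, T' x ≫ dag y = x ≫ dag (T'' y)) ∧
      (∀ x y, R x ≫ dag y = x ≫ dag (R y)) ∧ ∀ x, R (R x) + T'' (T' x) = x := by
  obtain ⟨n, T', T'', R, h1, h2, h3, h4⟩ := RightHilbertSpace.exists_dilation (𝕂 := 𝕂) T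
  refine ⟨n, T', T'', R, fun x => (h1 x).trans (nsmul_carrier_eq L n (T' x)), fun x y => ?_,
    fun x y => ?_, fun x => (L.add_eq (A := A) (R (R x)) (T'' (T' x))).symm.trans (h4 x)⟩
  · exact L.scalar.injective
      ((L.form_eq (A := B) (T' x) y).symm.trans ((h2 x y).trans (L.form_eq (A := A) x (T'' y))))
  · exact L.scalar.injective
      ((L.form_eq (A := A) (R x) y).symm.trans ((h3 x y).trans (L.form_eq (A := A) x (R y))))

/-- Fullness. The isometry `x ↦ (T' x, R x)` sends an orthonormal basis of `A` to orthonormal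
vectors of `B ⊕ A`, so there is a morphism `f` with the same values on the basis. The projection of
`f` to `B` is then `T'`, because their adjoints have the same coordinates. -/
theorem full_functor (L : HomLift C 𝕂) : L.functor.Full where
  map_surjective {A B} T := by
    obtain ⟨n, T', T'', R, hT, hT', hR, hRT⟩ := exists_dilation_hom L T
    obtain ⟨S, hS⟩ := exists_isOrthonormalBasis
      (fun x hx => exists_isDaggerMono_comp (starRingEquivOfHomLift L) x hx) A
    obtain ⟨P, i, j, hi, hj, hij, hji, -⟩ := exists_orthogonal_sum B A
    have hg : ∀ x y, (T' x ≫ i + R x ≫ j) ≫ dag (T' y ≫ i + R y ≫ j) = x ≫ dag y := fun x y => by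
      have : (T' x ≫ i + R x ≫ j) ≫ dag (T' y ≫ i + R y ≫ j) =
          R x ≫ dag (R y) + T' x ≫ dag (T' y) := by
        simp only [dag_add, dag_comp, Preadditive.add_comp, Preadditive.comp_add, Category.assoc,
          reassoc_of% hi, reassoc_of% hj, reassoc_of% hij, reassoc_of% hji, zero_comp, comp_zero,
          zero_add, add_comm]
      rw [this, hR, hT', ← Preadditive.comp_add, ← dag_add, hRT]
    obtain ⟨f, hf⟩ := hS.exists_hom (fun s => T' s.1 ≫ i + R s.1 ≫ j)
      (fun s => by rw [hg, hS.norm _ s.2])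
      (fun s t hst => by rw [hg, hS.orth _ s.2 _ t.2 fun h => hst (Subtype.ext h)])
    have hf1 : ∀ y : K ⟶ B, y ≫ i ≫ dag f = T'' y := fun y => by
      rw [← sub_eq_zero]
      apply hS.total
      intro s hs
      have e1 : (y ≫ i ≫ dag f) ≫ dag s = y ≫ dag (T' s) := by
        rw [Category.assoc, Category.assoc, ← dag_comp, hf ⟨s, hs⟩]
        simp only [dag_add, dag_comp, Preadditive.comp_add, reassoc_of% hi, reassoc_of% hij,
          zero_comp, add_zero]
      have e2 : T'' y ≫ dag s = y ≫ dag (T' s) := by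
        have := congrArg dag (hT' s y)
        simpa only [dag_comp, dag_dag] using this.symm
      rw [Preadditive.sub_comp, e1, e2, sub_self]
    have hf2 : ∀ x : K ⟶ A, x ≫ f ≫ dag i = T' x := fun x => by
      have h1 : ∀ y : K ⟶ B, (x ≫ f ≫ dag i - T' x) ≫ dag y = 0 := fun y => by
        rw [Preadditive.sub_comp, hT', ← hf1 y]
        simp only [dag_comp, dag_dag, Category.assoc, sub_self]
      exact sub_eq_zero.mp (eq_zero_of_comp_dag_eq_zero (h1 _))
    refine ⟨n • (f ≫ dag i), ?_⟩
    refine ContinuousLinearMap.ext (M₁ := (L.functor.obj A).carrier)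
      (M₂ := (L.functor.obj B).carrier) fun (x : K ⟶ A) => ?_
    refine Eq.trans ?_ (hT x).symm
    change x ≫ (n • (f ≫ dag i)) = n • T' x
    rw [Preadditive.comp_nsmul, hf2]

end HilbertCategory

theorem mainTheorem7 (C : Type u) [Category.{v} C] [HilbertCategory C] :
    (Nonempty (HomLift C ℝ) ∨ Nonempty (HomLift C ℂ) ∨ Nonempty (HomLift C ℍ[ℝ])) ∧
    (∀ L : HomLift C ℝ, IsDaggerFunctor L.functor ∧ L.functor.Full) ∧
    (∀ L : HomLift C ℂ, IsDaggerFunctor L.functor ∧ L.functor.Full) ∧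
    (∀ L : HomLift C ℍ[ℝ], IsDaggerFunctor L.functor ∧ L.functor.Full) := by
  refine ⟨?_, fun L => ⟨HilbertCategory.isDaggerFunctor_functor L, HilbertCategory.full_functor L⟩,
    fun L => ⟨HilbertCategory.isDaggerFunctor_functor L, HilbertCategory.full_functor L⟩,
    fun L => ⟨HilbertCategory.isDaggerFunctor_functor L, HilbertCategory.full_functor L⟩⟩
  rcases MonotoneCompleteDivisionRing.nonempty_starRingEquiv
    (End (HilbertCategory.K : C)) with
    ⟨⟨σ⟩⟩ | ⟨⟨σ⟩⟩ | ⟨⟨σ⟩⟩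
  · exact Or.inl ⟨HilbertCategory.homLift σ⟩
  · exact Or.inr (Or.inl ⟨HilbertCategory.homLift σ⟩)
  · exact Or.inr (Or.inr ⟨HilbertCategory.homLift σ⟩)
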